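/- Fix $\rho\in(0,1)$ and write $x\wedge y=\min\{x,y\}$. We use the following objects. *The law $\Psi^\rho$.* Let $Y_1(x),Y_2(x)$, $x\ge 1$, be independent Bernoulli($\rho$) variables, $W(x)=\sum_{y=1}^{x}(Y_2(y)-Y_1(y))$, $M(x)=\max_{0\le y\le x}W(y)$. Put $\sigma(0)=*$ and, for $x\ge1$, $\sigma(x)=1$ if $Y_1(x)=1$; $\sigma(x)=*$ if $Y_1(x)=0$ and $M(x)>M(x-1)$; $\sigma(x)=0$ otherwise. Let $\tilde\sigma$ be independent of $\sigma$ and constructed in the same way with $1-\rho$ in place of $\rho$, and for $x\ge 1$ let $\sigma(-x)=1,0,*$ according as $\tilde\sigma(x)=0,1,*$. Let $\overline\eta^*(x)\in\{0,1\}$, $x\neq0$, be obtained from $\sigma$ by turning each $*$ at a positive site into $1$ and each $*$ at a negative site into $0$. Finally let $\overline\eta(0)=0$, $\overline\eta(1)=1$, $\overline\eta(x)=\overline\eta^*(x-1)$ for $x>1$ and $\overline\eta(x)=\overline\eta^*(x)$ for $x<0$; $\Psi^\rho$ is the law of $\overline\eta$ on $\{0,1\}^{\mathbb Z}$. *The process.*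 In the totally asymmetric simple exclusion process (TASEP) on $\{0,1\}^{\mathbb Z}$ ($1$ = particle, $0$ = hole), each particle exchanges at rate $1$ with a hole immediately to its right. Follow a hole-particle pair (a hole with a particle immediately to its right): when its particle exchanges with a hole, the pair moves one step to the right, and when its hole exchanges with a particle, the pair moves one step to the left. Let $(\overline\eta_t)_{t\in\mathbb R}$ be the stationary Markov process of TASEP centred so that the pair is always at the sites $0$ (hole) and $1$ (particle), with $\overline\eta_t\sim\Psi^\rho$ for every $t$. Label holes by $\mathbb Z$ from left to right and particles by $\mathbb Z$ from right to left, the hole and the particle of the pair at time $0$ both having label $0$. Let $\overline L(a,b)$ be the time at which the particle labelled $b$ exchanges with the hole labelled $a$, let $\overline\xi(a,b)=\overline L(a+1,b)\wedge\overline L(a,b+1)-\overline L(a,b)$, and let $\overline\gamma\subset\mathbb Z^2$ be the set of all $(a,b)$ such that at some time the pair consists of the hole labelled $a$ and the particle labelled $b$. Let $\mathbf\Psi^\rho$ be the law of the process conditioned on $\overline L(0,0)=0$, i.e. the limit as $\epsilon\to0+$ (weak convergence of finite-dimensional distributions of right-continuous paths with left limits) of its law conditioned on $\overline L(0,0)>-\epsilon$.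 Let $\nu^\rho$ be the law of $((\overline\xi(a,b))_{(a,b)\in\mathbb Z^2},\overline\gamma)$ on $\mathbb R^{\mathbb Z^2}\times\{0,1\}^{\mathbb Z^2}$ under $\mathbf\Psi^\rho$. **Proposition.** Let $(\xi,\gamma)\sim\nu^\rho$. For every $h\ge0$, $$\mathbb P[\xi(0,0)>h]=\left(1+\frac{\rho(1-\rho)h}{(1-\rho)^2+\rho^2}\right)\bigl(1+\rho(1-\rho)h\bigr)e^{-h}.$$ Moreover, the law of $\xi(0,0)$ is a mixture (with nonnegative weights of sum $1$) of the Gamma$(1,1)$, Gamma$(2,1)$ and Gamma$(3,1)$ distributions (shape $k$, rate $1$), and for $\rho=1/2$ the weights are $1/4$, $1/2$, $1/4$ respectively. -/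

import Mathlib

open MeasureTheory ProbabilityTheory Filter Topology Set

noncomputable section

namespace TasepPair

/-! ### The stationary law as seen from a hole-particle pair -/

/-- The three possible contents of a site. -/
inductive Site where
  | hole : Site
  | particle : Site
  | star : Site

instance : MeasurableSpace Site := ⊤

/-- Particle configurations on `ℤ`: `true` is a particle, `false` is a hole. -/
abbrev Config := ℤ → Bool

/-- `W(x) = R₂(x) - R₁(x)` with `Rᵢ(x) = Yᵢ(1) + ⋯ + Yᵢ(x)`. -/
def walk (Y₁ Y₂ : ℕ → Bool) (x : ℕ) : ℤ :=
  ∑ y ∈ Finset.Icc 1 x, (((Y₂ y).toNat : ℤ) - ((Y₁ y).toNat : ℤ))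

/-- `M(x) = max_{0 ≤ y ≤ x} W(y)`. -/
def walkMax (Y₁ Y₂ : ℕ → Bool) (x : ℕ) : ℤ :=
  (Finset.range (x + 1)).sup' ⟨0, by simp⟩ (walk Y₁ Y₂)

/-- The configuration `σ(x)`, `x ≥ 0`: it has a star at `0`, and for `x ≥ 1` it copies `Y₁`, except
that a hole becomes a star at the points where `M` increases. (`Y₁ 0` and `Y₂ 0` are not used.) -/
def halfConfig (Y₁ Y₂ : ℕ → Bool) (x : ℕ) : Site :=
  if x = 0 then Site.star
  else if Y₁ x = true then Site.particle
  else if walkMax Y₁ Y₂ (x - 1) < walkMax Y₁ Y₂ x then Site.star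
  else Site.hole

/-- I.i.d. Bernoulli(`p`) variables indexed by `ℕ`. -/
def bernoulliSeq (p : unitInterval) : Measure (ℕ → Bool) :=
  Measure.infinitePi (fun _ : ℕ => bernoulliMeasure true false p)

/-- The law `π_p` of `σ(x)`, `x ≥ 0`, for independent Bernoulli(`p`) sequences `Y₁`, `Y₂`. -/
def halfLaw (p : unitInterval) : Measure (ℕ → Site) :=
  ((bernoulliSeq p).prod (bernoulliSeq p)).map (fun Y => halfConfig Y.1 Y.2)

/-- Exchange of holes and particles. -/
def Site.flip : Site → Site
  | .hole => .particle
  | .particle => .hole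
  | .star => .star

/-- The configuration on `ℤ` that is `σ` on the right and the reflection of `σ'` with holes and
particles exchanged on the left. -/
def glue (σ σ' : ℕ → Site) (x : ℤ) : Site :=
  if 0 ≤ x then σ x.toNat else (σ' (-x).toNat).flip

/-- Stars at positive sites become particles and stars at negative sites become holes.
(The value at the origin is not used.) -/
def resolve (σ : ℤ → Site) (x : ℤ) : Bool :=
  match σ x with
  | .hole => false
  | .particle => true
  | .star => decide (0 < x)

/-- The star at the origin is replaced by a hole at `0` followed by a particle at `1`. -/
def openPair (η : ℤ → Bool) : Config := fun x =>
  if x = 0 then false else if x = 1 then true else if 1 < x then η (x - 1) else η x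

/-- The law `Ψ^ρ` on configurations. -/
def Psi (ρ : unitInterval) : Measure Config :=
  ((halfLaw ρ).prod (halfLaw (unitInterval.symm ρ))).map
    (fun σ => openPair (resolve (glue σ.1 σ.2)))

/-! ### The dynamics: TASEP as seen from a hole-particle pair -/

/-- A state `(η, a, b)`: the configuration `η` centred so that the pair occupies the sites `0`
(hole) and `1` (particle), the label `a` of the hole of the pair, and the label `b` of its
particle. -/
abbrev State := Config × ℤ × ℤ

/-- The contents of the sites `x` and `x + 1` are exchanged. -/
def swapAt (x : ℤ) (η : Config) : Config := fun z => η (Equiv.swap x (x + 1) z)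

/-- There is a particle at `x` and a hole at `x + 1`. -/
def Active (x : ℤ) (X : State) : Prop := X.1 x = true ∧ X.1 (x + 1) = false

instance (x : ℤ) (X : State) : Decidable (Active x X) := by unfold Active; infer_instance

/-- The effect of a particle jump from `x` to `x + 1`. If `x = 1` then the particle of the pair has
jumped and the pair moves to the right; if `x = -1` then a particle has jumped over the hole of the
pair and the pair moves to the left. In both cases the configuration is centred again. -/
def jump (x : ℤ) (X : State) : State :=
  if x = 1 then (fun z => swapAt 1 X.1 (z + 1), X.2.1 + 1, X.2.2)
  else if x = -1 then (fun z => swapAt (-1) X.1 (z - 1), X.2.1, X.2.2 + 1)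
  else (swapAt x X.1, X.2.1, X.2.2)

/-- Bounded functions of the state that depend on finitely many sites and on the two labels. -/
def IsCylinder (f : State → ℝ) : Prop :=
  (∃ N : ℕ, ∀ η η' : Config, (∀ x : ℤ, |x| ≤ N → η x = η' x) →
    ∀ a b : ℤ, f (η, a, b) = f (η', a, b)) ∧
  ∃ C : ℝ, ∀ X, |f X| ≤ C

/-- The generator: every particle with a hole to its right jumps at rate `1`. For a cylinder
function only finitely many terms are nonzero. -/
def generator (f : State → ℝ) (X : State) : ℝ :=
  ∑ᶠ x : ℤ, if Active x X then f (jump x X) - f X else 0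

/-- Two-sided trajectories `t ↦ (η_t, a_t, b_t)`: right-continuous with left limits (for the
product topology), with `(a_0, b_0) = (0, 0)`, and such that the labels change exactly when the
pair moves. -/
structure Path where
  /-- The state at each time. -/
  at' : ℝ → State
  pair : ∀ t, (at' t).1 0 = false ∧ (at' t).1 1 = true
  right_cont : ∀ t, ContinuousWithinAt at' (Ici t) t
  left_lim : ∀ t, ∃ X : State, Tendsto at' (𝓝[<] t) (𝓝 X) ∧
    ((at' t).2 = X.2 ∨ ∃ x : ℤ, (x = 1 ∨ x = -1) ∧ Active x X ∧ at' t = jump x X)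
  mono_hole : Monotone (fun t => (at' t).2.1)
  mono_particle : Monotone (fun t => (at' t).2.2)
  label_zero : (at' 0).2 = (0, 0)

/-- The σ-algebra generated by the evaluations. -/
instance : MeasurableSpace Path := MeasurableSpace.comap Path.at' inferInstance

/-- The state at time `r`, with labels counted from those of the pair at time `s`. -/
def Path.seen (s r : ℝ) (ω : Path) : State :=
  ((ω.at' r).1, (ω.at' r).2.1 - (ω.at' s).2.1, (ω.at' r).2.2 - (ω.at' s).2.2)

/-- The information on the trajectory up to time `s` (labels are counted from time `s`, since the
normalization at time `0` is not known at an earlier time). -/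
@[reducible] def past (s : ℝ) : MeasurableSpace Path :=
  ⨆ r : Iic s, MeasurableSpace.comap (Path.seen s r) inferInstance

/-- `Q` is the law of the two-sided stationary TASEP as seen from a hole-particle pair: at each
time the configuration has law `Ψ^ρ`, and `Q` solves the martingale problem of the generator, i.e.
`E[f(X_t) - f(X_s) - ∫_s^t (generator f)(X_r) dr ; A] = 0` for all `s ≤ t`, all cylinder functions
`f` and all events `A` of the past of `s`. -/
structure IsStationaryLaw (ρ : unitInterval) (Q : Measure Path) : Prop where
  prob : IsProbabilityMeasure Q
  stationary : ∀ t : ℝ, Q.map (fun ω => (ω.at' t).1) = Psi ρ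
  martingale : ∀ s t : ℝ, s ≤ t → ∀ f : State → ℝ, IsCylinder f →
    ∀ A : Set Path, MeasurableSet[past s] A →
      ∫ ω in A, f (ω.seen s t) ∂Q =
        ∫ ω in A, f (ω.seen s s) ∂Q + ∫ r in s..t, ∫ ω in A, generator f (ω.seen s r) ∂Q

/-! ### Labels, switching times, and the environment -/

/-- Holes are numbered from left to right, the hole at site `0` having number `0`. -/
def holeNumber (η : Config) (y : ℤ) : ℤ :=
  if 0 ≤ y then (((Finset.Ioc 0 y).filter (fun z => η z = false)).card : ℤ)
  else -(((Finset.Ioc y 0).filter (fun z => η z = false)).card : ℤ)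

/-- Particles are numbered from right to left, the particle at site `1` having number `0`. -/
def particleNumber (η : Config) (x : ℤ) : ℤ :=
  if x ≤ 1 then (((Finset.Ico x 1).filter (fun z => η z = true)).card : ℤ)
  else -(((Finset.Ioc 1 x).filter (fun z => η z = true)).card : ℤ)

/-- In the given state the hole labelled `a` is at site `y`. -/
def HoleAt (X : State) (a y : ℤ) : Prop := X.1 y = false ∧ X.2.1 + holeNumber X.1 y = a

/-- In the given state the particle labelled `b` is at site `x`. -/
def ParticleAt (X : State) (b x : ℤ) : Prop := X.1 x = true ∧ X.2.2 + particleNumber X.1 x = b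

/-- `L(a, b)`: the time when the particle labelled `b` is exchanged with the hole labelled `a`,
that is, the first time when that hole is to the left of that particle (`⊤` if this never
happens). -/
def switchTime (ω : Path) (a b : ℤ) : EReal :=
  sInf ((fun t : ℝ => (t : EReal)) ''
    {t | ∃ y x : ℤ, HoleAt (ω.at' t) a y ∧ ParticleAt (ω.at' t) b x ∧ y < x})

/-- `ξ(a, b) = min (L(a + 1, b)) (L(a, b + 1)) - L(a, b)`. -/
def weight (ω : Path) (v : ℤ × ℤ) : ℝ :=
  (min (switchTime ω (v.1 + 1) v.2) (switchTime ω v.1 (v.2 + 1)) - switchTime ω v.1 v.2).toReal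

open Classical in
/-- The indicator of the set of all `(a, b)` such that at some time the hole labelled `a` is at
site `0` and the particle labelled `b` is at site `1`. -/
def trace (ω : Path) (v : ℤ × ℤ) : Bool :=
  decide (∃ t : ℝ, HoleAt (ω.at' t) v.1 0 ∧ ParticleAt (ω.at' t) v.2 1)

/-- `ℝ^(ℤ²) × {0,1}^(ℤ²)`. -/
abbrev Environment := (ℤ × ℤ → ℝ) × (ℤ × ℤ → Bool)

/-- The pair `(ξ, γ)` read off from a trajectory. -/
def environment (ω : Path) : Environment := (weight ω, trace ω)

/-! ### Conditioning on a jump of the pair at time zero -/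

/-- `Q'` is `Q` conditioned on `L(0, 0) = 0`: the limit, for the weak convergence of
finite-dimensional distributions, of `Q` conditioned on `L(0, 0) > -ε` as `ε → 0+`. -/
structure IsConditionedOnJump (Q Q' : Measure Path) : Prop where
  prob : IsProbabilityMeasure Q'
  tendsto : ∀ (n : ℕ) (t : Fin n → ℝ) (g : BoundedContinuousFunction (Fin n → State) ℝ),
    Tendsto
      (fun ε : ℝ => ∫ ω, g (fun i => ω.at' (t i))
        ∂(ProbabilityTheory.cond Q {ω | ((-ε : ℝ) : EReal) < switchTime ω 0 0}))
      (𝓝[>] 0) (𝓝 (∫ ω, g (fun i => ω.at' (t i)) ∂Q'))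

/-- `ν` is the limiting law `ν^ρ` of the environment along a geodesic: the law of `(ξ, γ)` for the
stationary process conditioned on `L(0, 0) = 0`. -/
def IsLimitEnvironment (ρ : unitInterval) (ν : Measure Environment) : Prop :=
  ∃ Q Q' : Measure Path, IsStationaryLaw ρ Q ∧ IsConditionedOnJump Q Q' ∧ ν = Q'.map environment

end TasepPair

end

namespace TasepPair

/-! ### The leading block of a half-line configuration -/

/-! Write `c = ρ(1 - ρ)`. Everything reduces to the probability `F(t)` that the stationary pair does
not move during a time `t`.

The event "no motion so far" alone does not give a closed equation, but it does together with
blocks: `k` particles directly to the right of the pair and `j` holes directly to its left. Inside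
such a block nothing can jump, and no jump creates a block while the pair stays put. Hence the
indicator of the `(j, k)` block can only be lost at its two ends, and the generator maps it to a
combination of the `(j, k + 1)`, `(j + 1, k)` and `(j, k)` indicators (`generator_blockIndicator`).
The initial values are explicit and factorize over the two half-lines (`Psi_block`). The resulting
linear hierarchy has the product solution `blockProb`, and bounded solutions are unique
(`hierarchy_eq_zero`). At `j = k = 0` this gives `F(t) = (1 + c t)² exp(-t)`
(`IsStationaryLaw.labels_eq`).

Conditioning on a motion at time zero is Palm inversion: given a motion in `(-ε, 0]`, the pair rests
during `[0, h]` with probability `(F(h) - F(h + ε)) / (F(0) - F(ε))`, which tends to `F'(h) / F'(0)`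
(`labels_conditioned`). Here `-F'(0) = 1 - 2c = (1 - ρ)² + ρ²`. Almost surely under the conditioned
law, `ξ(0, 0)` is the time of the first motion after zero (`Path.lt_weight_iff`), so this quotient
is its tail. Expanding the quadratic factor of the tail in the Gamma tails gives the mixture
(`eq_gamma_mixture`). -/

lemma walk_succ (Y₁ Y₂ : ℕ → Bool) (x : ℕ) :
    walk Y₁ Y₂ (x + 1) =
      walk Y₁ Y₂ x + (((Y₂ (x + 1)).toNat : ℤ) - ((Y₁ (x + 1)).toNat : ℤ)) := by
  unfold walk
  rw [Finset.sum_Icc_succ_top (by omega)]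

lemma walk_le_walkMax (Y₁ Y₂ : ℕ → Bool) {x y : ℕ} (h : y ≤ x) :
    walk Y₁ Y₂ y ≤ walkMax Y₁ Y₂ x :=
  Finset.le_sup' (walk Y₁ Y₂) (by simpa [Nat.lt_succ_iff] using h)

lemma walkMax_lt_iff (Y₁ Y₂ : ℕ → Bool) (x : ℕ) :
    walkMax Y₁ Y₂ x < walkMax Y₁ Y₂ (x + 1) ↔ ∀ y ≤ x, walk Y₁ Y₂ y < walk Y₁ Y₂ (x + 1) := by
  constructor
  · intro h y hy
    have h1 : walkMax Y₁ Y₂ x < walk Y₁ Y₂ (x + 1) := by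
      by_contra! hc
      refine absurd h (not_lt.2 (Finset.sup'_le _ _ fun z hz => ?_))
      rcases (Nat.lt_succ_iff.1 (Finset.mem_range.1 hz)).lt_or_eq with hz | rfl
      · exact walk_le_walkMax _ _ (Nat.lt_succ_iff.1 hz)
      · exact hc
    exact (walk_le_walkMax _ _ hy).trans_lt h1
  · intro h
    refine lt_of_lt_of_le ?_ (walk_le_walkMax Y₁ Y₂ le_rfl)
    exact (Finset.sup'_lt_iff _).2 fun z hz => h z (Nat.lt_succ_iff.1 (Finset.mem_range.1 hz))

lemma halfConfig_succ_ne_hole_iff (Y₁ Y₂ : ℕ → Bool) (x : ℕ) :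
    halfConfig Y₁ Y₂ (x + 1) ≠ Site.hole ↔
      Y₁ (x + 1) = true ∨ ∀ y ≤ x, walk Y₁ Y₂ y < walk Y₁ Y₂ (x + 1) := by
  rw [← walkMax_lt_iff]
  unfold halfConfig
  by_cases h1 : Y₁ (x + 1) = true <;>
    by_cases h2 : walkMax Y₁ Y₂ x < walkMax Y₁ Y₂ (x + 1) <;> simp [h1, h2]

lemma walk_mono_of_forall {Y₁ Y₂ : ℕ → Bool} {n : ℕ} (h : ∀ x, 1 ≤ x → x ≤ n → Y₂ x = true)
    {x y : ℕ} (hxy : x ≤ y) (hy : y ≤ n) : walk Y₁ Y₂ x ≤ walk Y₁ Y₂ y := by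
  induction y, hxy using Nat.le_induction with
  | base => exact le_rfl
  | succ y hxy ih =>
    refine (ih (by omega)).trans ?_
    rw [walk_succ, h (y + 1) (by omega) hy]
    cases Y₁ (y + 1) <;> simp

/-- As long as `Y₂` is one the walk never decreases, and it goes up exactly where `Y₁` is zero.
Every such site is therefore a strict record, that is, a star. -/
lemma halfConfig_ne_hole_of_forall {Y₁ Y₂ : ℕ → Bool} {n : ℕ}
    (h : ∀ x, 1 ≤ x → x ≤ n → Y₂ x = true) {x : ℕ} (h1 : 1 ≤ x) (hx : x ≤ n) :
    halfConfig Y₁ Y₂ x ≠ Site.hole := by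
  obtain ⟨x, rfl⟩ : ∃ z, x = z + 1 := ⟨x - 1, by omega⟩
  rw [halfConfig_succ_ne_hole_iff]
  by_cases h2 : Y₁ (x + 1) = true
  · exact Or.inl h2
  · refine Or.inr fun y hy => ?_
    have := walk_mono_of_forall (Y₁ := Y₁) h hy (by omega)
    rw [walk_succ, h (x + 1) h1 hx]
    simp only [Bool.not_eq_true] at h2
    simp [h2]
    omega

/-- There is no hole up to `k` if and only if `Y₂` has no zero up to `k`, or `Y₁` is one from the
first zero of `Y₂` up to `k`. -/
lemma forall_halfConfig_ne_hole_iff (Y₁ Y₂ : ℕ → Bool) (k : ℕ) :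
    (∀ x, 1 ≤ x → x ≤ k → halfConfig Y₁ Y₂ x ≠ Site.hole) ↔
      (∀ x, 1 ≤ x → x ≤ k → Y₂ x = true) ∨
      ∃ j, (1 ≤ j ∧ j ≤ k) ∧ (∀ x, 1 ≤ x → x < j → Y₂ x = true) ∧ Y₂ j = false ∧
        ∀ x, j ≤ x → x ≤ k → Y₁ x = true := by
  constructor
  · intro h
    by_cases hall : ∀ x, 1 ≤ x → x ≤ k → Y₂ x = true
    · exact Or.inl hall
    right
    push Not at hall
    classical
    set j := Nat.find hall with hj
    obtain ⟨hj1, hjk, hjf⟩ := Nat.find_spec hall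
    rw [← hj] at hj1 hjk hjf
    have hmin : ∀ x, 1 ≤ x → x < j → Y₂ x = true := by
      intro x hx1 hxj
      have := Nat.find_min hall hxj
      by_contra hc
      exact this ⟨hx1, by omega, hc⟩
    have hjf' : Y₂ j = false := by simpa using hjf
    refine ⟨j, ⟨hj1, hjk⟩, hmin, hjf', ?_⟩
    -- At the first zero `j` of `Y₂` the step is nonpositive, so `j` is not a record; it must be a
    -- particle, and the walk drops strictly below its value at `j - 1`. One step regains at most
    -- one, which only ties the earlier value and is not a strict record, so the next site is again
    -- a particle and the walk does not go up.
    have key : ∀ n, j + n ≤ k →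
        Y₁ (j + n) = true ∧ walk Y₁ Y₂ (j + n) < walk Y₁ Y₂ (j - 1) := by
      intro n
      induction n with
      | zero =>
        intro hn
        obtain ⟨i, hi⟩ : ∃ i, j = i + 1 := ⟨j - 1, by omega⟩
        have hh := h j hj1 hjk
        rw [hi] at hjf' hh ⊢
        simp only [add_zero, Nat.add_sub_cancel]
        rw [halfConfig_succ_ne_hole_iff] at hh
        have hw := walk_succ Y₁ Y₂ i
        rw [hjf'] at hw
        rcases hh with hh | hh
        · rw [hh] at hw
          exact ⟨hh, by simp at hw; omega⟩
        · have := hh i le_rfl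
          cases hY : Y₁ (i + 1) <;> simp [hY] at hw <;> omega
      | succ n ih =>
        intro hn
        obtain ⟨-, ih2⟩ := ih (by omega)
        have hh := h (j + n + 1) (by omega) (by omega)
        rw [halfConfig_succ_ne_hole_iff] at hh
        have hw := walk_succ Y₁ Y₂ (j + n)
        rw [← add_assoc]
        have hY2 : ((Y₂ (j + n + 1)).toNat : ℤ) ≤ 1 := by
          cases Y₂ (j + n + 1) <;> simp
        rcases hh with hh | hh
        · rw [hh] at hw
          refine ⟨hh, ?_⟩
          simp at hw
          omega
        · have := hh (j - 1) (by omega)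
          have h3 : (0 : ℤ) ≤ ((Y₁ (j + n + 1)).toNat : ℤ) := by positivity
          omega
    intro x hx1 hx2
    obtain ⟨n, rfl⟩ := Nat.exists_eq_add_of_le hx1
    exact (key n hx2).1
  · rintro (h | ⟨j, ⟨hj1, hjk⟩, h2, -, h1⟩) x hx1 hxk
    · exact halfConfig_ne_hole_of_forall h hx1 hxk
    · rcases lt_or_ge x j with hxj | hxj
      · exact halfConfig_ne_hole_of_forall (n := j - 1) (fun y hy hy' => h2 y hy (by omega)) hx1
          (by omega)
      · obtain ⟨x, rfl⟩ : ∃ z, x = z + 1 := ⟨x - 1, by omega⟩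
        exact (halfConfig_succ_ne_hole_iff _ _ _).2 (Or.inl (h1 _ hxj hxk))

lemma measurableSet_of_comp {α β : Type*} [MeasurableSpace α] [MeasurableSpace β]
    [DiscreteMeasurableSpace β] {f : α → β} (hf : Measurable f) (P : β → Prop) :
    MeasurableSet {a | P (f a)} :=
  measurableSet_setOfPred.2 ((Measurable.of_discrete (f := P)).comp hf)

instance : DiscreteMeasurableSpace Site := ⟨fun _ => trivial⟩

lemma measurable_walk (x : ℕ) :
    Measurable fun Y : (ℕ → Bool) × (ℕ → Bool) => walk Y.1 Y.2 x := by
  unfold walk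
  have h : Measurable fun b : Bool => (b.toNat : ℤ) := measurable_of_countable _
  exact Finset.measurable_fun_sum _ fun y _ =>
    (h.comp ((measurable_pi_apply y).comp measurable_snd)).sub
      (h.comp ((measurable_pi_apply y).comp measurable_fst))

lemma measurable_walkMax (x : ℕ) :
    Measurable fun Y : (ℕ → Bool) × (ℕ → Bool) => walkMax Y.1 Y.2 x := by
  have h := Finset.measurable_sup' (s := Finset.range (x + 1)) (Finset.nonempty_range_add_one)
    (f := fun n (Y : (ℕ → Bool) × (ℕ → Bool)) => walk Y.1 Y.2 n) fun n _ => measurable_walk n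
  convert h using 1
  ext Y
  exact (Finset.sup'_apply Finset.nonempty_range_add_one
    (fun n (Y : (ℕ → Bool) × (ℕ → Bool)) => walk Y.1 Y.2 n) Y).symm

lemma measurable_halfConfig :
    Measurable fun Y : (ℕ → Bool) × (ℕ → Bool) => halfConfig Y.1 Y.2 := by
  refine measurable_pi_lambda _ fun x => ?_
  unfold halfConfig
  refine Measurable.ite (by simp) measurable_const
    (Measurable.ite ?_ measurable_const (Measurable.ite ?_ measurable_const measurable_const))
  · exact measurableSet_of_comp (f := fun Y : (ℕ → Bool) × (ℕ → Bool) => Y.1 x) (by fun_prop)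
      (fun b => b = true)
  · exact measurableSet_lt (measurable_walkMax _) (measurable_walkMax _)

instance (p : unitInterval) : IsProbabilityMeasure (bernoulliSeq p) := by
  unfold bernoulliSeq; infer_instance

instance (p : unitInterval) : IsProbabilityMeasure (halfLaw p) := by
  unfold halfLaw
  exact Measure.isProbabilityMeasure_map measurable_halfConfig.aemeasurable

lemma bernoulliSeq_forall_true (p : unitInterval) (s : Finset ℕ) :
    bernoulliSeq p {Y | ∀ x ∈ s, Y x = true} = ENNReal.ofReal p ^ s.card := by
  have : {Y : ℕ → Bool | ∀ x ∈ s, Y x = true} = Set.pi s (fun _ => {true}) := by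
    ext; simp [Set.mem_pi]
  rw [this, bernoulliSeq, Measure.infinitePi_pi _ (fun _ _ => MeasurableSet.singleton _)]
  rw [Finset.prod_congr rfl (fun i _ => bernoulliMeasure_apply _ (MeasurableSet.singleton _))]
  simp [ENNReal.ofReal, unitInterval.toNNReal, Real.toNNReal_of_nonneg p.2.1]
  rfl

lemma bernoulliSeq_forall_true_and_false (p : unitInterval) (s : Finset ℕ) {j : ℕ} (hj : j ∉ s) :
    bernoulliSeq p {Y | (∀ x ∈ s, Y x = true) ∧ Y j = false} =
      ENNReal.ofReal p ^ s.card * ENNReal.ofReal (1 - p) := by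
  have : {Y : ℕ → Bool | (∀ x ∈ s, Y x = true) ∧ Y j = false} =
      Set.pi (insert j s : Finset ℕ) (fun x => if x = j then {false} else {true}) := by
    ext Y
    simp only [Set.mem_ofPred_eq, Set.mem_pi, Finset.coe_insert, Set.mem_insert_iff,
      Finset.mem_coe, forall_eq_or_imp, if_true, Set.mem_singleton_iff]
    rw [and_comm]
    refine and_congr_right fun _ => forall₂_congr fun x hx => ?_
    rw [if_neg (by rintro rfl; exact hj hx), Set.mem_singleton_iff]
  rw [this, bernoulliSeq, Measure.infinitePi_pi _ (fun _ _ => MeasurableSet.of_discrete),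
    Finset.prod_insert hj, if_pos rfl, mul_comm]
  congr 1
  · rw [Finset.prod_congr rfl (g := fun _ => ENNReal.ofReal p), Finset.prod_const]
    intro i hi
    rw [if_neg (by rintro rfl; exact hj hi), bernoulliMeasure_apply _ (MeasurableSet.singleton _)]
    simp [ENNReal.ofReal, unitInterval.toNNReal, Real.toNNReal_of_nonneg p.2.1]
    rfl
  · rw [bernoulliMeasure_apply _ (MeasurableSet.singleton _)]
    have : (0 : ℝ) ≤ 1 - p := by linarith [p.2.2]
    simp [ENNReal.ofReal, unitInterval.toNNReal, Real.toNNReal_of_nonneg this]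
    rfl

lemma measurableSet_forall_true (s : Finset ℕ) :
    MeasurableSet {Y : ℕ → Bool | ∀ x ∈ s, Y x = true} := by
  have : {Y : ℕ → Bool | ∀ x ∈ s, Y x = true} = Set.pi s (fun _ => {true}) := by
    ext; simp [Set.mem_pi]
  rw [this]
  exact MeasurableSet.pi s.countable_toSet fun _ _ => MeasurableSet.singleton _

/-- The probability that the first `k` sites contain no hole. -/
lemma halfLaw_forall_ne_hole (p : unitInterval) (k : ℕ) :
    halfLaw p {σ | ∀ x, 1 ≤ x → x ≤ k → σ x ≠ Site.hole} =
      ENNReal.ofReal ((p : ℝ) ^ k * (1 + k * (1 - p))) := by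
  have hp0 : (0 : ℝ) ≤ p := p.2.1
  have hp1 : (0 : ℝ) ≤ 1 - p := by linarith [p.2.2]
  have hms : MeasurableSet {σ : ℕ → Site | ∀ x, 1 ≤ x → x ≤ k → σ x ≠ Site.hole} := by
    simp only [Set.ofPred_forall]
    exact MeasurableSet.iInter fun x => MeasurableSet.iInter fun _ => MeasurableSet.iInter fun _ =>
      measurableSet_of_comp (f := fun σ : ℕ → Site => σ x) (by fun_prop) (fun s => s ≠ Site.hole)
  rw [halfLaw, Measure.map_apply measurable_halfConfig hms]
  set B : Set ((ℕ → Bool) × (ℕ → Bool)) :=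
    univ ×ˢ {Y | ∀ x ∈ Finset.Icc 1 k, Y x = true} with hB
  set C : ℕ → Set ((ℕ → Bool) × (ℕ → Bool)) := fun j =>
    {Y | ∀ x ∈ Finset.Icc j k, Y x = true} ×ˢ
      {Y | (∀ x ∈ Finset.Ico 1 j, Y x = true) ∧ Y j = false} with hC
  have hset : ((fun Y : (ℕ → Bool) × (ℕ → Bool) => halfConfig Y.1 Y.2) ⁻¹'
      {σ | ∀ x, 1 ≤ x → x ≤ k → σ x ≠ Site.hole}) = B ∪ ⋃ j ∈ Finset.Icc 1 k, C j := by
    ext Y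
    simp only [Set.mem_preimage, Set.mem_ofPred_eq, forall_halfConfig_ne_hole_iff]
    simp only [hB, hC, Set.mem_union, Set.mem_prod, Set.mem_univ, true_and, Set.mem_ofPred_eq,
      Finset.mem_Icc, Finset.mem_Ico, Set.mem_iUnion, exists_prop, and_imp]
    refine or_congr Iff.rfl (exists_congr fun j => and_congr_right fun _ => ?_)
    tauto
  have hCm : ∀ j, MeasurableSet (C j) := fun j =>
    (measurableSet_forall_true _).prod (by
      rw [Set.ofPred_and]
      exact (measurableSet_forall_true _).inter
        (measurableSet_of_comp (f := fun Y : ℕ → Bool => Y j) (by fun_prop) (fun b => b = false)))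
  -- A first zero of `Y₂` at `j` costs `p ^ (j - 1) * (1 - p)`, and ones of `Y₁` from `j` to `k`
  -- cost `p ^ (k - j + 1)`. The product does not depend on `j`, whence the factor `k` in the total.
  have hCmu : ∀ j ∈ Finset.Icc 1 k, ((bernoulliSeq p).prod (bernoulliSeq p)) (C j) =
      ENNReal.ofReal ((p : ℝ) ^ k * (1 - p)) := by
    intro j hj
    obtain ⟨h1, h2⟩ := Finset.mem_Icc.1 hj
    rw [hC, Measure.prod_prod, bernoulliSeq_forall_true,
      bernoulliSeq_forall_true_and_false _ _ (by simp), ← mul_assoc, ← pow_add]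
    rw [ENNReal.ofReal_mul (by positivity), ENNReal.ofReal_pow hp0]
    congr 2
    simp
    omega
  have hdisj : Disjoint B (⋃ j ∈ Finset.Icc 1 k, C j) := by
    simp only [Set.disjoint_iUnion_right]
    intro j hj
    refine Set.disjoint_left.2 fun Y hYB hYC => ?_
    have h1 := hYB.2 j hj
    have h2 := hYC.2.2
    simp [h1] at h2
  have hpair : (↑(Finset.Icc 1 k) : Set ℕ).PairwiseDisjoint C := by
    have main : ∀ i j, 1 ≤ i → i < j → Disjoint (C i) (C j) := by
      intro i j hi hij
      refine Set.disjoint_left.2 fun Y hY hY' => ?_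
      have h1 := hY.2.2
      have h2 := hY'.2.1 i (by simp; omega)
      simp [h1] at h2
    intro i hi j hj hij
    simp only [Finset.coe_Icc, Set.mem_Icc] at hi hj
    rcases lt_or_gt_of_ne hij with h | h
    · exact main i j hi.1 h
    · exact (main j i hj.1 h).symm
  rw [hset, measure_union hdisj (Finset.measurableSet_biUnion _ fun j _ => hCm j),
    measure_biUnion_finset hpair fun j _ => hCm j, Finset.sum_congr rfl hCmu, hB,
    Measure.prod_prod, bernoulliSeq_forall_true]
  simp only [measure_univ, one_mul, Nat.card_Icc, Nat.add_sub_cancel, Finset.sum_const,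
    nsmul_eq_mul]
  rw [← ENNReal.ofReal_pow hp0, ← ENNReal.ofReal_natCast, ← ENNReal.ofReal_mul (by positivity),
    ← ENNReal.ofReal_add (by positivity) (by positivity)]
  congr 1
  ring

/-! ### Blocks next to the pair -/

/-- There are particles at the `k` sites to the right of the pair, and holes at the `j` sites to
its left. -/
def Block (j k : ℕ) (η : Config) : Prop :=
  (∀ z : ℤ, 2 ≤ z → z ≤ k + 1 → η z = true) ∧ ∀ z : ℤ, -(j : ℤ) ≤ z → z ≤ -1 → η z = false

lemma measurableSet_block (j k : ℕ) : MeasurableSet {η | Block j k η} := by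
  unfold Block
  rw [Set.ofPred_and]
  refine MeasurableSet.inter ?_ ?_ <;> simp only [Set.ofPred_forall]
  · exact MeasurableSet.iInter fun z => MeasurableSet.iInter fun _ => MeasurableSet.iInter fun _ =>
      measurableSet_of_comp (f := fun η : Config => η z) (by fun_prop) (fun b => b = true)
  · exact MeasurableSet.iInter fun z => MeasurableSet.iInter fun _ => MeasurableSet.iInter fun _ =>
      measurableSet_of_comp (f := fun η : Config => η z) (by fun_prop) (fun b => b = false)

lemma measurable_openPair_resolve_glue :
    Measurable fun σ : (ℕ → Site) × (ℕ → Site) => openPair (resolve (glue σ.1 σ.2)) := by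
  have hg : ∀ x : ℤ, Measurable fun σ : (ℕ → Site) × (ℕ → Site) => glue σ.1 σ.2 x := by
    intro x
    unfold glue
    split_ifs
    · fun_prop
    · exact (Measurable.of_discrete (f := Site.flip)).comp (by fun_prop)
  have hr : ∀ x : ℤ, Measurable fun σ : (ℕ → Site) × (ℕ → Site) =>
      resolve (glue σ.1 σ.2) x := by
    intro x
    unfold resolve
    exact (Measurable.of_discrete (f := fun s : Site => (match s with
      | .hole => false
      | .particle => true
      | .star => decide (0 < x) : Bool))).comp (hg x)
  refine measurable_pi_lambda _ fun x => ?_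
  unfold openPair
  split_ifs
  · exact measurable_const
  · exact measurable_const
  · exact hr _
  · exact hr _

/-- Stars count as particles on the right, and after the flip they count as holes on the left, so on
both sides a block means "no hole" in the half-line configuration. Opening the pair shifts the right
half by one site and leaves the left half in place. -/
lemma block_openPair_iff (j k : ℕ) (σ σ' : ℕ → Site) :
    Block j k (openPair (resolve (glue σ σ'))) ↔
      (∀ x, 1 ≤ x → x ≤ k → σ x ≠ Site.hole) ∧ ∀ x, 1 ≤ x → x ≤ j → σ' x ≠ Site.hole := by
  have hright : ∀ n : ℕ, 1 ≤ n →
      (openPair (resolve (glue σ σ')) (n + 1) = true ↔ σ n ≠ Site.hole) := by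
    intro n hn
    have h1 : ¬ ((n : ℤ) + 1 = 0) := by omega
    have h2 : ¬ ((n : ℤ) + 1 = 1) := by omega
    have h3 : (1 : ℤ) < n + 1 := by omega
    have h4 : (0 : ℤ) < n := by omega
    simp only [openPair, h1, h2, h3, if_true, if_false, add_sub_cancel_right, resolve, glue,
      h4.le, Int.toNat_natCast]
    cases σ n <;> simp; omega
  have hleft : ∀ n : ℕ, 1 ≤ n →
      (openPair (resolve (glue σ σ')) (-n) = false ↔ σ' n ≠ Site.hole) := by
    intro n hn
    have h1 : ¬ (-(n : ℤ) = 0) := by omega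
    have h2 : ¬ (-(n : ℤ) = 1) := by omega
    have h3 : ¬ ((1 : ℤ) < -n) := by omega
    have h4 : ¬ ((0 : ℤ) ≤ -n) := by omega
    simp only [openPair, h1, h2, h3, if_false, resolve, glue, h4, neg_neg, Int.toNat_natCast]
    cases σ' n <;> simp [Site.flip]
  refine and_congr ⟨fun h x hx hx' => ?_, fun h z hz hz' => ?_⟩
    ⟨fun h x hx hx' => ?_, fun h z hz hz' => ?_⟩
  · exact (hright x hx).1 (h _ (by omega) (by omega))
  · obtain ⟨n, rfl⟩ : ∃ n : ℕ, z = n + 1 := ⟨(z - 1).toNat, by omega⟩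
    exact (hright n (by omega)).2 (h n (by omega) (by omega))
  · exact (hleft x hx).1 (h _ (by omega) (by omega))
  · obtain ⟨n, rfl⟩ : ∃ n : ℕ, z = -n := ⟨(-z).toNat, by omega⟩
    exact (hleft n (by omega)).2 (h n (by omega) (by omega))

/-- The probability of a block under the stationary law. -/
lemma Psi_block (ρ : unitInterval) (j k : ℕ) :
    Psi ρ {η | Block j k η} = ENNReal.ofReal
      ((ρ : ℝ) ^ k * (1 + k * (1 - ρ)) * ((1 - (ρ : ℝ)) ^ j * (1 + j * ρ))) := by
  have h0 : (0 : ℝ) ≤ ρ := ρ.2.1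
  have h1 : (0 : ℝ) ≤ 1 - ρ := by linarith [ρ.2.2]
  rw [Psi, Measure.map_apply measurable_openPair_resolve_glue (measurableSet_block j k)]
  have : (fun σ : (ℕ → Site) × (ℕ → Site) => openPair (resolve (glue σ.1 σ.2))) ⁻¹'
      {η | Block j k η} = {σ | ∀ x, 1 ≤ x → x ≤ k → σ x ≠ Site.hole} ×ˢ
        {σ | ∀ x, 1 ≤ x → x ≤ j → σ x ≠ Site.hole} := by
    ext σ
    simp only [Set.mem_preimage, Set.mem_ofPred_eq, block_openPair_iff, Set.mem_prod]
  rw [this, Measure.prod_prod, halfLaw_forall_ne_hole, halfLaw_forall_ne_hole,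
    ← ENNReal.ofReal_mul (by positivity)]
  simp

/-! ### The generator acting on block indicators -/

open Classical in
/-- The indicator of the event that the labels vanish and that the pair is surrounded by a
block. -/
noncomputable def blockIndicator (j k : ℕ) (X : State) : ℝ :=
  if X.2 = (0, 0) ∧ Block j k X.1 then 1 else 0

lemma blockIndicator_of_pos {j k : ℕ} {X : State} (h : X.2 = (0, 0)) (h' : Block j k X.1) :
    blockIndicator j k X = 1 := if_pos ⟨h, h'⟩

lemma blockIndicator_of_labels {j k : ℕ} {X : State} (h : X.2 ≠ (0, 0)) :
    blockIndicator j k X = 0 := if_neg fun h' => h h'.1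

lemma blockIndicator_of_not_block {j k : ℕ} {X : State} (h : ¬ Block j k X.1) :
    blockIndicator j k X = 0 := if_neg fun h' => h h'.2

lemma blockIndicator_nonneg (j k : ℕ) (X : State) : 0 ≤ blockIndicator j k X := by
  unfold blockIndicator; split_ifs <;> norm_num

lemma blockIndicator_le_one (j k : ℕ) (X : State) : blockIndicator j k X ≤ 1 := by
  unfold blockIndicator; split_ifs <;> norm_num

lemma measurable_blockIndicator (j k : ℕ) : Measurable (blockIndicator j k) := by
  unfold blockIndicator
  refine Measurable.ite ?_ measurable_const measurable_const
  rw [Set.ofPred_and]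
  exact (measurableSet_of_comp (f := fun X : State => X.2) measurable_snd
    (fun l => l = (0, 0))).inter
    (measurable_fst (measurableSet_block j k))

lemma isCylinder_blockIndicator (j k : ℕ) : IsCylinder (blockIndicator j k) := by
  refine ⟨⟨j + k + 1, fun η η' h a b => ?_⟩, 1, fun X => ?_⟩
  · have : Block j k η ↔ Block j k η' := by
      refine and_congr (forall₃_congr fun z hz hz' => ?_) (forall₃_congr fun z hz hz' => ?_)
      · rw [h z (by rw [abs_of_nonneg (by omega)]; push_cast; omega)]
      · rw [h z (by rw [abs_of_nonpos (by omega)]; push_cast; omega)]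
    classical
    unfold blockIndicator
    congr 1
    exact propext (and_congr_right fun _ => this)
  · rw [abs_of_nonneg (blockIndicator_nonneg _ _ _)]
    exact blockIndicator_le_one _ _ _

/-- A motion of the pair raises one label by one, so nonnegative labels cannot land on `(0, 0)`.
Nonnegativity is available later because labels are counted from an earlier time and are monotone.
-/
lemma jump_labels_ne {x : ℤ} {X : State} (hx : x = 1 ∨ x = -1) (ha : 0 ≤ X.2.1) (hb : 0 ≤ X.2.2) :
    (jump x X).2 ≠ (0, 0) := by
  rcases hx with rfl | rfl <;> simp [jump] <;> omega

lemma jump_of_ne {x : ℤ} {X : State} (hx : x ≠ 1) (hx' : x ≠ -1) :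
    jump x X = (swapAt x X.1, X.2) := by simp [jump, hx, hx']

lemma swapAt_of_ne {x z : ℤ} (η : Config) (h1 : z ≠ x) (h2 : z ≠ x + 1) : swapAt x η z = η z := by
  simp [swapAt, Equiv.swap_apply_of_ne_of_ne h1 h2]

lemma swapAt_left (x : ℤ) (η : Config) : swapAt x η x = η (x + 1) := by simp [swapAt]

lemma swapAt_right (x : ℤ) (η : Config) : swapAt x η (x + 1) = η x := by simp [swapAt]

lemma block_succ_right (j k : ℕ) (η : Config) :
    Block j (k + 1) η ↔ Block j k η ∧ η (k + 2) = true := by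
  constructor
  · intro h
    refine ⟨⟨fun z hz hz' => h.1 z hz (by push_cast; omega), h.2⟩, h.1 _ (by omega) ?_⟩
    push_cast; omega
  · rintro ⟨h, h'⟩
    refine ⟨fun z hz hz' => ?_, h.2⟩
    push_cast at hz'
    rcases eq_or_ne z (k + 2) with rfl | hne
    · exact h'
    · exact h.1 z hz (by omega)

lemma block_succ_left (j k : ℕ) (η : Config) :
    Block (j + 1) k η ↔ Block j k η ∧ η (-j - 1) = false := by
  constructor
  · intro h
    refine ⟨⟨h.1, fun z hz hz' => h.2 z (by push_cast; omega) hz'⟩, h.2 _ ?_ (by omega)⟩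
    push_cast; omega
  · rintro ⟨h, h'⟩
    refine ⟨h.1, fun z hz hz' => ?_⟩
    push_cast at hz
    rcases eq_or_ne z (-j - 1) with rfl | hne
    · exact h'
    · exact h.2 z (by omega) hz'

/-- A jump cannot create a block. -/
lemma not_block_swapAt {j k : ℕ} {x : ℤ} {X : State} (h0 : X.1 0 = false)
    (hx : x ≠ 1) (hx' : x ≠ -1) (hact : Active x X) (h : ¬ Block j k X.1) :
    ¬ Block j k (swapAt x X.1) := by
  have hx0 : x ≠ 0 := by rintro rfl; simpa [h0] using hact.1
  intro hB
  apply h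
  refine ⟨fun z hz hz' => ?_, fun z hz hz' => ?_⟩
  · by_contra hc
    by_cases hzx : z = x
    · exact hc (hzx ▸ hact.1)
    · by_cases hzx' : z = x + 1
      -- A particle arriving in the block leaves a hole at `x`, and since `x ≠ 1` this site also
      -- belongs to the block.
      · have := hB.1 x (by omega) (by omega)
        rw [swapAt_left] at this
        exact hc (hzx' ▸ this)
      · have := hB.1 z hz hz'
        rw [swapAt_of_ne _ hzx hzx'] at this
        exact hc this
  · by_contra hc
    by_cases hzx' : z = x + 1
    · exact hc (hzx' ▸ hact.2)
    · by_cases hzx : z = x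
      · have := hB.2 (x + 1) (by omega) (by omega)
        rw [swapAt_right] at this
        exact hc (hzx ▸ this)
      · have := hB.2 z hz hz'
        rw [swapAt_of_ne _ hzx hzx'] at this
        exact hc this

/-- Outside the two ends of the block, a jump does not affect the indicator. -/
lemma blockIndicator_jump_of_ne {j k : ℕ} {x : ℤ} {X : State} (h0 : X.1 0 = false)
    (ha : 0 ≤ X.2.1) (hb : 0 ≤ X.2.2) (hact : Active x X)
    (hk : x ≠ k + 1) (hj : x ≠ -j - 1) :
    blockIndicator j k (jump x X) = blockIndicator j k X := by
  have hx0 : x ≠ 0 := by rintro rfl; simpa [h0] using hact.1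
  by_cases hB : X.2 = (0, 0) ∧ Block j k X.1
  · have hx1 : x ≠ 1 := by
      rintro rfl
      have := hB.2.1 2 le_rfl (by omega)
      exact absurd hact.2 (by simp [this])
    have hx2 : x ≠ -1 := by
      rintro rfl
      have := hB.2.2 (-1) (by omega) le_rfl
      exact absurd hact.1 (by simp [this])
    rw [blockIndicator_of_pos hB.1 hB.2, jump_of_ne hx1 hx2]
    refine blockIndicator_of_pos hB.1 ⟨fun z hz hz' => ?_, fun z hz hz' => ?_⟩
    · have hz1 : z ≠ x := by
        rintro rfl
        have := hB.2.1 (z + 1) (by omega) (by omega)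
        exact absurd hact.2 (by simp [this])
      have hz2 : z ≠ x + 1 := by
        rintro rfl
        have := hB.2.1 (x + 1) (by omega) (by omega)
        exact absurd hact.2 (by simp [this])
      simpa [swapAt_of_ne _ hz1 hz2] using hB.2.1 z hz hz'
    · have hz1 : z ≠ x := by
        rintro rfl
        have := hB.2.2 z (by omega) (by omega)
        exact absurd hact.1 (by simp [this])
      have hz2 : z ≠ x + 1 := by
        rintro rfl
        have := hB.2.2 x (by omega) (by omega)
        exact absurd hact.1 (by simp [this])
      simpa [swapAt_of_ne _ hz1 hz2] using hB.2.2 z hz hz'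
  · rw [show blockIndicator j k X = 0 from if_neg hB]
    by_cases hx : x = 1 ∨ x = -1
    · exact blockIndicator_of_labels (jump_labels_ne hx ha hb)
    · push Not at hx
      rw [jump_of_ne hx.1 hx.2]
      refine if_neg fun h => hB ⟨h.1, ?_⟩
      by_contra hc
      exact not_block_swapAt h0 hx.1 hx.2 hact hc h.2

/-- The last particle of the block (the particle of the pair if `k = 0`) can jump exactly when the
next site is a hole, that is, when the block does not extend to `k + 1`. Its jump destroys the
indicator: it opens a hole in the block, or it moves the pair if `k = 0`. -/
lemma blockIndicator_jump_right {j k : ℕ} {X : State} (h0 : X.1 0 = false)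
    (h1 : X.1 1 = true) (ha : 0 ≤ X.2.1) (hb : 0 ≤ X.2.2) :
    (if Active (k + 1) X then blockIndicator j k (jump (k + 1) X) - blockIndicator j k X else 0) =
      blockIndicator j (k + 1) X - blockIndicator j k X := by
  by_cases hl : X.2 = (0, 0)
  swap
  · rw [blockIndicator_of_labels hl, blockIndicator_of_labels hl]
    split_ifs with hact
    · rcases eq_or_ne k 0 with rfl | hk
      · rw [blockIndicator_of_labels (jump_labels_ne (by simp) ha hb)]
      · rw [jump_of_ne (by omega) (by omega),
          blockIndicator_of_labels (X := (swapAt _ X.1, X.2)) hl]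
    · simp
  by_cases hB : Block j k X.1
  · rw [blockIndicator_of_pos hl hB]
    have hk1 : X.1 (k + 1) = true := by
      rcases eq_or_ne k 0 with rfl | hk
      · simpa using h1
      · exact hB.1 _ (by omega) le_rfl
    by_cases hk2 : X.1 (k + 2) = true
    · rw [blockIndicator_of_pos hl ((block_succ_right _ _ _).2 ⟨hB, hk2⟩), if_neg, sub_self]
      rintro ⟨-, h⟩
      rw [show (k : ℤ) + 1 + 1 = k + 2 by ring, hk2] at h
      simp at h
    · rw [blockIndicator_of_not_block (k := k + 1) fun h => hk2 ((block_succ_right _ _ _).1 h).2,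
        if_pos ⟨hk1, by rw [show (k : ℤ) + 1 + 1 = k + 2 by ring]; simpa using hk2⟩]
      congr 1
      rcases eq_or_ne k 0 with rfl | hk
      · exact blockIndicator_of_labels (jump_labels_ne (by simp) ha hb)
      · rw [jump_of_ne (by omega) (by omega)]
        refine blockIndicator_of_not_block fun h => ?_
        have := h.1 (k + 1) (by omega) le_rfl
        simp only at this
        rw [swapAt_left, show (k : ℤ) + 1 + 1 = k + 2 by ring] at this
        exact hk2 this
  · rw [blockIndicator_of_not_block hB,
      blockIndicator_of_not_block (k := k + 1) fun h => hB ((block_succ_right _ _ _).1 h).1]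
    split_ifs with hact
    · rcases eq_or_ne k 0 with rfl | hk
      · rw [blockIndicator_of_labels (jump_labels_ne (by simp) ha hb)]
      · rw [jump_of_ne (by omega) (by omega), blockIndicator_of_not_block
          (not_block_swapAt h0 (by omega) (by omega) hact hB)]
    · simp

/-- Mirror image of `blockIndicator_jump_right`: the outermost hole of the block (the hole of the
pair if `j = 0`) is hit exactly when a particle sits just outside it. -/
lemma blockIndicator_jump_left {j k : ℕ} {X : State} (h0 : X.1 0 = false)
    (ha : 0 ≤ X.2.1) (hb : 0 ≤ X.2.2) :
    (if Active (-j - 1) X then blockIndicator j k (jump (-j - 1) X) - blockIndicator j k X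
      else 0) = blockIndicator (j + 1) k X - blockIndicator j k X := by
  by_cases hl : X.2 = (0, 0)
  swap
  · rw [blockIndicator_of_labels hl, blockIndicator_of_labels hl]
    split_ifs with hact
    · rcases eq_or_ne j 0 with rfl | hk
      · rw [blockIndicator_of_labels (jump_labels_ne (by simp) ha hb)]
      · rw [jump_of_ne (by omega) (by omega),
          blockIndicator_of_labels (X := (swapAt _ X.1, X.2)) hl]
    · simp
  by_cases hB : Block j k X.1
  · rw [blockIndicator_of_pos hl hB]
    have hk1 : X.1 (-j - 1 + 1) = false := by
      rcases eq_or_ne j 0 with rfl | hk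
      · simpa using h0
      · exact hB.2 _ (by omega) (by omega)
    by_cases hk2 : X.1 (-j - 1) = false
    · rw [blockIndicator_of_pos hl ((block_succ_left _ _ _).2 ⟨hB, hk2⟩), if_neg, sub_self]
      rintro ⟨h, -⟩
      rw [hk2] at h
      simp at h
    · rw [blockIndicator_of_not_block (j := j + 1) fun h => hk2 ((block_succ_left _ _ _).1 h).2,
        if_pos ⟨by simpa using hk2, hk1⟩]
      congr 1
      rcases eq_or_ne j 0 with rfl | hk
      · exact blockIndicator_of_labels (jump_labels_ne (by simp) ha hb)
      · rw [jump_of_ne (by omega) (by omega)]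
        refine blockIndicator_of_not_block fun h => ?_
        have := h.2 (-j - 1 + 1) (by omega) (by omega)
        simp only at this
        rw [swapAt_right] at this
        exact hk2 this
  · rw [blockIndicator_of_not_block hB,
      blockIndicator_of_not_block (j := j + 1) fun h => hB ((block_succ_left _ _ _).1 h).1]
    split_ifs with hact
    · rcases eq_or_ne j 0 with rfl | hk
      · rw [blockIndicator_of_labels (jump_labels_ne (by simp) ha hb)]
      · rw [jump_of_ne (by omega) (by omega), blockIndicator_of_not_block
          (not_block_swapAt h0 (by omega) (by omega) hact hB)]
    · simp

/-- The hierarchy of the blocks is closed under the generator. -/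
lemma generator_blockIndicator {j k : ℕ} {X : State} (h0 : X.1 0 = false)
    (h1 : X.1 1 = true) (ha : 0 ≤ X.2.1) (hb : 0 ≤ X.2.2) :
    generator (blockIndicator j k) X = blockIndicator j (k + 1) X + blockIndicator (j + 1) k X -
      2 * blockIndicator j k X := by
  unfold generator
  rw [finsum_eq_sum_of_support_subset (s := {(k : ℤ) + 1, -(j : ℤ) - 1}),
    Finset.sum_pair (by omega), blockIndicator_jump_right h0 h1 ha hb,
    blockIndicator_jump_left h0 ha hb]
  · ring
  · intro x hx
    by_contra hc
    simp only [Finset.coe_insert, Finset.coe_singleton, Set.mem_insert_iff,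
      Set.mem_singleton_iff, not_or] at hc
    apply hx
    simp only
    split_ifs with hact
    · rw [blockIndicator_jump_of_ne h0 ha hb hact hc.1 hc.2, sub_self]
    · rfl

/-! ### The hierarchy of block probabilities -/

/-- A bounded solution of the integrated hierarchy with zero initial value vanishes. -/
lemma hierarchy_eq_zero {δ : ℕ → ℕ → ℝ → ℝ} {T C : ℝ}
    (hbound : ∀ j k, ∀ t ∈ Icc 0 T, |δ j k t| ≤ C)
    (heq : ∀ j k, ∀ t ∈ Icc 0 T,
      δ j k t = ∫ r in (0 : ℝ)..t, (δ j (k + 1) r + δ (j + 1) k r - 2 * δ j k r))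
    {j k : ℕ} {t : ℝ} (ht : t ∈ Icc 0 T) : δ j k t = 0 := by
  -- Picard iteration: the coefficients 1, 1 and 2 add up to the factor 4. The bound must be uniform
  -- in `j` and `k`, because each iteration raises the indices.
  have key : ∀ n : ℕ, ∀ j k, ∀ t ∈ Icc 0 T, |δ j k t| ≤ C * (4 * t) ^ n / n.factorial := by
    intro n
    induction n with
    | zero => simpa using hbound
    | succ n ih =>
      intro j k t ht
      rw [heq j k t ht]
      have hint : ∫ r in (0 : ℝ)..t, 4 * (C * (4 * r) ^ n / n.factorial) =
          C * (4 * t) ^ (n + 1) / (n + 1).factorial := by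
        have : ∀ r : ℝ, 4 * (C * (4 * r) ^ n / n.factorial) =
            (C * 4 ^ (n + 1) / n.factorial) * r ^ n := by
          intro r; ring
        simp only [this]
        rw [intervalIntegral.integral_const_mul, integral_pow, Nat.factorial_succ]
        have h1 : ((n : ℝ) + 1) ≠ 0 := by positivity
        have h2 : (n.factorial : ℝ) ≠ 0 := by positivity
        push_cast
        field_simp
        simp only [ne_eq, Nat.add_eq_zero_iff, one_ne_zero, and_false, not_false_eq_true, zero_pow,
          sub_zero]
        ring
      rw [← hint, ← Real.norm_eq_abs]
      refine intervalIntegral.norm_integral_le_of_norm_le ht.1 ?_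
        (Continuous.intervalIntegrable (by fun_prop) _ _)
      refine Eventually.of_forall fun r hr => ?_
      have hr' : r ∈ Icc 0 T := ⟨hr.1.le, hr.2.trans ht.2⟩
      have h1 := ih j (k + 1) r hr'
      have h2 := ih (j + 1) k r hr'
      have h3 := ih j k r hr'
      rw [Real.norm_eq_abs]
      rw [abs_le] at *
      constructor <;> linarith [h1.1, h2.1, h3.1, h1.2, h2.2, h3.2]
  have hlim : Tendsto (fun n : ℕ => C * (4 * t) ^ n / n.factorial) atTop (𝓝 0) := by
    have := (FloorSemiring.tendsto_pow_div_factorial_atTop (4 * t)).const_mul C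
    simpa [mul_div_assoc] using this
  have := ge_of_tendsto' hlim fun n => key n j k t ht
  exact abs_nonpos_iff.1 this

/-- The probability of the `(j, k)` block and of no motion of the pair during a time `t`. -/
noncomputable def blockProb (ρ : ℝ) (j k : ℕ) (t : ℝ) : ℝ :=
  Real.exp (-t) * (ρ ^ k * (1 + k * (1 - ρ) + ρ * (1 - ρ) * t)) *
    ((1 - ρ) ^ j * (1 + j * ρ + ρ * (1 - ρ) * t))

/-- With `A k = ρ ^ k * (1 + k * (1 - ρ) + c t)` and `B j` its mirror image, one has `A k' = A (k +
1) - ρ * A k` and `B j' = B (j + 1) - (1 - ρ) * B j`. The factor `exp (-t)` supplies the remaining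
loss rate, for a total of 2. -/
lemma hasDerivAt_blockProb (ρ : ℝ) (j k : ℕ) (t : ℝ) :
    HasDerivAt (blockProb ρ j k)
      (blockProb ρ j (k + 1) t + blockProb ρ (j + 1) k t - 2 * blockProb ρ j k t) t := by
  have h1 : HasDerivAt (fun t : ℝ => Real.exp (-t)) (-Real.exp (-t)) t := by
    simpa using (hasDerivAt_id t).neg.exp
  have h2 : ∀ c d : ℝ,
      HasDerivAt (fun t : ℝ => d * (c + ρ * (1 - ρ) * t)) (d * (ρ * (1 - ρ))) t := by
    intro c d
    simpa using (((hasDerivAt_id t).const_mul (ρ * (1 - ρ))).const_add c).const_mul d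
  refine ((h1.mul (h2 (1 + k * (1 - ρ)) (ρ ^ k))).mul
    (h2 (1 + j * ρ) ((1 - ρ) ^ j))).congr_deriv ?_
  simp only [blockProb, Pi.mul_apply]
  push_cast
  ring

lemma continuous_blockProb (ρ : ℝ) (j k : ℕ) : Continuous (blockProb ρ j k) := by
  unfold blockProb; fun_prop

lemma blockProb_eq_integral (ρ : ℝ) (j k : ℕ) (t : ℝ) :
    blockProb ρ j k t = blockProb ρ j k 0 + ∫ r in (0 : ℝ)..t,
      (blockProb ρ j (k + 1) r + blockProb ρ (j + 1) k r - 2 * blockProb ρ j k r) := by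
  have := continuous_blockProb ρ
  rw [intervalIntegral.integral_eq_sub_of_hasDerivAt
    (fun r _ => hasDerivAt_blockProb ρ j k r) (Continuous.intervalIntegrable (by fun_prop) _ _)]
  ring

/-- Bernoulli's inequality together with `ρ (2 - ρ) = 1 - (1 - ρ)² ≤ 1`. It provides the bound
uniform in the block sizes that the uniqueness argument needs. -/
lemma pow_mul_one_add_le_one {ρ : ℝ} (h0 : 0 ≤ ρ) (h1 : ρ ≤ 1) (k : ℕ) :
    ρ ^ k * (1 + k * (1 - ρ)) ≤ 1 := by
  have hb : 1 + k * (1 - ρ) ≤ (1 + (1 - ρ)) ^ k :=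
    one_add_mul_le_pow (by linarith) k
  calc ρ ^ k * (1 + k * (1 - ρ)) ≤ ρ ^ k * (1 + (1 - ρ)) ^ k := by gcongr
    _ = (ρ * (1 + (1 - ρ))) ^ k := (mul_pow _ _ _).symm
    _ ≤ 1 := pow_le_one₀ (mul_nonneg h0 (by linarith)) (by nlinarith [sq_nonneg (1 - ρ)])

lemma abs_blockProb_le {ρ : ℝ} (h0 : 0 ≤ ρ) (h1 : ρ ≤ 1) (j k : ℕ) {t : ℝ} (ht : 0 ≤ t) :
    |blockProb ρ j k t| ≤ (1 + t) * (1 + t) := by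
  have hq : 0 ≤ 1 - ρ := by linarith
  have key : ∀ p : ℝ, 0 ≤ p → p ≤ 1 → ∀ k : ℕ,
      p ^ k * (1 + k * (1 - p) + ρ * (1 - ρ) * t) ≤ 1 + t := by
    intro p hp hp' k
    have h2 : p ^ k * (ρ * (1 - ρ) * t) ≤ t := by
      have h3 : p ^ k * (ρ * (1 - ρ)) ≤ 1 :=
        mul_le_one₀ (pow_le_one₀ hp hp') (by positivity) (by nlinarith)
      nlinarith
    nlinarith [pow_mul_one_add_le_one hp hp' k]
  have hk := key ρ h0 h1 k
  have hj := key (1 - ρ) hq (by linarith) j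
  rw [show 1 - (1 - ρ) = ρ by ring] at hj
  unfold blockProb
  rw [abs_of_nonneg (by positivity), mul_assoc]
  refine (mul_le_of_le_one_left (by positivity) (Real.exp_le_one_iff.2 (by linarith))).trans ?_
  gcongr

/-- Block probabilities are determined by the hierarchy. -/
lemma eq_blockProb {ρ : ℝ} (h0 : 0 ≤ ρ) (h1 : ρ ≤ 1) {u : ℕ → ℕ → ℝ → ℝ}
    (hcont : ∀ j k, ContinuousOn (u j k) (Ici 0))
    (hbound : ∀ j k t, 0 ≤ t → |u j k t| ≤ 1)
    (hinit : ∀ j k, u j k 0 = blockProb ρ j k 0)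
    (heq : ∀ j k t, 0 ≤ t → u j k t = u j k 0 +
      ∫ r in (0 : ℝ)..t, (u j (k + 1) r + u (j + 1) k r - 2 * u j k r))
    {j k : ℕ} {t : ℝ} (ht : 0 ≤ t) : u j k t = blockProb ρ j k t := by
  have hc := continuous_blockProb ρ
  refine sub_eq_zero.1 (hierarchy_eq_zero (δ := fun j k t => u j k t - blockProb ρ j k t)
    (T := t) (C := 1 + (1 + t) * (1 + t)) (fun j k r hr => ?_)
    (fun j k r hr => ?_) (right_mem_Icc.2 ht))
  · refine (abs_sub _ _).trans (add_le_add (hbound j k r hr.1) ?_)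
    refine (abs_blockProb_le h0 h1 j k hr.1).trans ?_
    have := hr.1
    have := hr.2
    gcongr
  · have hi : ∀ j k, IntervalIntegrable (u j k) volume 0 r := fun j k =>
      ((hcont j k).mono (by rw [uIcc_of_le hr.1]; exact Icc_subset_Ici_self)).intervalIntegrable
    rw [heq j k r hr.1, blockProb_eq_integral ρ j k r, hinit, add_sub_add_left_eq_sub,
      ← intervalIntegral.integral_sub]
    · congr 1
      ext x
      ring
    · exact ((hi _ _).add (hi _ _)).sub ((hi _ _).const_mul 2)
    · exact Continuous.intervalIntegrable (by fun_prop) _ _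

/-! ### The law of the time during which the pair does not move -/

lemma measurable_at (t : ℝ) : Measurable fun ω : Path => ω.at' t :=
  (measurable_pi_apply t).comp (comap_measurable Path.at')

lemma measurable_labels (t : ℝ) : Measurable fun ω : Path => (ω.at' t).2 :=
  measurable_snd.comp (measurable_at t)

lemma measurable_seen (s t : ℝ) : Measurable fun ω : Path => ω.seen s t := by
  have h1 := measurable_labels t
  have h2 := measurable_labels s
  exact (measurable_fst.comp (measurable_at t)).prodMk
    (((measurable_fst.comp h1).sub (measurable_fst.comp h2)).prodMk
      ((measurable_snd.comp h1).sub (measurable_snd.comp h2)))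

lemma measurableSet_labels_eq (s t : ℝ) :
    MeasurableSet {ω : Path | (ω.at' t).2 = (ω.at' s).2} :=
  measurableSet_eq_fun (measurable_labels t) (measurable_labels s)

lemma Path.labels_le (ω : Path) {s t : ℝ} (h : s ≤ t) : (ω.at' s).2 ≤ (ω.at' t).2 :=
  ⟨ω.mono_hole h, ω.mono_particle h⟩

lemma Path.labels_eq_of_le (ω : Path) {s u t : ℝ} (h : s ≤ u) (h' : u ≤ t)
    (ht : (ω.at' t).2 = (ω.at' s).2) : (ω.at' u).2 = (ω.at' s).2 :=
  le_antisymm (ht ▸ ω.labels_le h') (ω.labels_le h)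

lemma Path.seen_labels_eq_zero_iff (ω : Path) (s t : ℝ) :
    (ω.seen s t).2 = (0, 0) ↔ (ω.at' t).2 = (ω.at' s).2 := by
  simp only [Path.seen, Prod.ext_iff, sub_eq_zero]

/-- The past of `u` only records labels relative to time `u`, but "no motion between `s` and `u`" is
the vanishing of the relative label at time `s`. This makes it an admissible test event in the
martingale problem started at `u`. -/
lemma measurableSet_past_labels_eq {s u : ℝ} (h : s ≤ u) :
    MeasurableSet[past u] {ω : Path | (ω.at' u).2 = (ω.at' s).2} := by
  have hle : MeasurableSpace.comap (Path.seen u s) inferInstance ≤ past u :=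
    le_iSup (fun r : Iic u => MeasurableSpace.comap (Path.seen u r) inferInstance) ⟨s, h⟩
  refine hle _ ⟨{X : State | X.2 = (0, 0)}, ?_, ?_⟩
  · exact measurableSet_of_comp (f := fun X : State => X.2) measurable_snd (fun l => l = (0, 0))
  · ext ω
    simp only [Set.mem_preimage, Set.mem_ofPred_eq, Path.seen_labels_eq_zero_iff]
    exact eq_comm

/-! ### Block masses of the stationary process -/

/-- The probability that at time `t` the pair has not moved since time `s` and is surrounded by
the `(j, k)` block. -/
noncomputable def blockMass (Q : Measure Path) (s : ℝ) (j k : ℕ) (t : ℝ) : ℝ :=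
  ∫ ω, blockIndicator j k (ω.seen s t) ∂Q

section

variable {ρ : unitInterval} {Q : Measure Path}

lemma integrable_blockIndicator [IsProbabilityMeasure Q] (s t : ℝ) (j k : ℕ) :
    Integrable (fun ω => blockIndicator j k (ω.seen s t)) Q := by
  refine Integrable.of_bound
    ((measurable_blockIndicator j k).comp (measurable_seen s t)).aestronglyMeasurable 1
    (Eventually.of_forall fun ω => ?_)
  rw [Real.norm_eq_abs, abs_of_nonneg (blockIndicator_nonneg _ _ _)]
  exact blockIndicator_le_one _ _ _

lemma abs_blockMass_le [IsProbabilityMeasure Q] (s : ℝ) (j k : ℕ) (t : ℝ) :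
    |blockMass Q s j k t| ≤ 1 := by
  have h := norm_integral_le_of_norm_le_const (μ := Q)
    (f := fun ω => blockIndicator j k (ω.seen s t)) (C := 1) (Eventually.of_forall fun ω => by
      rw [Real.norm_eq_abs, abs_of_nonneg (blockIndicator_nonneg _ _ _)]
      exact blockIndicator_le_one _ _ _)
  simpa [blockMass] using h

/-- By monotonicity of the labels, resting during `[s, t]` means resting during `[s, u]` and during
`[u, t]`. The martingale problem started at `u` thus yields increments of the mass counted from `s`.
-/
lemma setIntegral_blockIndicator_seen {s u t : ℝ} (h : s ≤ u) (h' : u ≤ t) (j k : ℕ) :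
    ∫ ω in {ω : Path | (ω.at' u).2 = (ω.at' s).2}, blockIndicator j k (ω.seen u t) ∂Q =
      blockMass Q s j k t := by
  rw [← integral_indicator (measurableSet_labels_eq s u), blockMass]
  congr 1
  ext ω
  by_cases hω : (ω.at' u).2 = (ω.at' s).2
  · rw [Set.indicator_of_mem (by exact hω)]
    simp only [Path.seen, hω]
  · rw [Set.indicator_of_notMem (by exact hω), blockIndicator_of_labels]
    rw [Ne, Path.seen_labels_eq_zero_iff]
    exact fun hc => hω (ω.labels_eq_of_le h h' hc)

lemma generator_seen (ω : Path) {u r : ℝ} (h : u ≤ r) (j k : ℕ) :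
    generator (blockIndicator j k) (ω.seen u r) = blockIndicator j (k + 1) (ω.seen u r) +
      blockIndicator (j + 1) k (ω.seen u r) - 2 * blockIndicator j k (ω.seen u r) :=
  generator_blockIndicator (ω.pair r).1 (ω.pair r).2 (sub_nonneg.2 (ω.mono_hole h))
    (sub_nonneg.2 (ω.mono_particle h))

lemma IsStationaryLaw.blockMass_eq (hQ : IsStationaryLaw ρ Q) {s u t : ℝ} (h : s ≤ u)
    (h' : u ≤ t) (j k : ℕ) :
    blockMass Q s j k t = blockMass Q s j k u + ∫ r in u..t,
      (blockMass Q s j (k + 1) r + blockMass Q s (j + 1) k r - 2 * blockMass Q s j k r) := by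
  have := hQ.prob
  have hm := hQ.martingale u t h' _ (isCylinder_blockIndicator j k) _
    (measurableSet_past_labels_eq h)
  rw [setIntegral_blockIndicator_seen h h', setIntegral_blockIndicator_seen h le_rfl] at hm
  rw [hm]
  congr 1
  refine intervalIntegral.integral_congr fun r hr => ?_
  rw [uIcc_of_le h'] at hr
  have hi := fun j k => (integrable_blockIndicator (Q := Q) u r j k).integrableOn
    (s := {ω : Path | (ω.at' u).2 = (ω.at' s).2})
  simp only [generator_seen _ hr.1]
  rw [integral_sub, integral_add (hi _ _) (hi _ _), integral_const_mul,
    setIntegral_blockIndicator_seen h hr.1, setIntegral_blockIndicator_seen h hr.1,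
    setIntegral_blockIndicator_seen h hr.1]
  · exact (hi _ _).add (hi _ _)
  · exact (hi _ _).const_mul 2

/-- The integrated equation has an integrand bounded by 4, so the masses are Lipschitz. This
supplies the integrability needed to subtract the explicit solution. -/
lemma IsStationaryLaw.continuousOn_blockMass (hQ : IsStationaryLaw ρ Q) (s : ℝ) (j k : ℕ) :
    ContinuousOn (blockMass Q s j k) (Ici s) := by
  have := hQ.prob
  have key : ∀ u t, s ≤ u → u ≤ t →
      |blockMass Q s j k t - blockMass Q s j k u| ≤ 4 * |t - u| := by
    intro u t hu ht
    rw [hQ.blockMass_eq hu ht, add_sub_cancel_left, ← Real.norm_eq_abs]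
    refine intervalIntegral.norm_integral_le_of_norm_le_const fun r _ => ?_
    have h1 := abs_blockMass_le (Q := Q) s j (k + 1) r
    have h2 := abs_blockMass_le (Q := Q) s (j + 1) k r
    have h3 := abs_blockMass_le (Q := Q) s j k r
    rw [Real.norm_eq_abs]
    rw [abs_le] at *
    constructor <;> linarith [h1.1, h2.1, h3.1, h1.2, h2.2, h3.2]
  refine (LipschitzOnWith.of_dist_le_mul (K := 4) fun t ht u hu => ?_).continuousOn
  rw [Real.dist_eq, Real.dist_eq]
  rcases le_total u t with h | h
  · exact key u t hu h
  · rw [abs_sub_comm, abs_sub_comm t]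
    exact key t u ht h

lemma IsStationaryLaw.blockMass_self (hQ : IsStationaryLaw ρ Q) (s : ℝ) (j k : ℕ) :
    blockMass Q s j k s = blockProb ρ j k 0 := by
  have h0 : (0 : ℝ) ≤ ρ := ρ.2.1
  have h1 : (0 : ℝ) ≤ 1 - ρ := by linarith [ρ.2.2]
  have hm : Measurable fun ω : Path => (ω.at' s).1 := measurable_fst.comp (measurable_at s)
  have hms : MeasurableSet {ω : Path | Block j k (ω.at' s).1} := hm (measurableSet_block j k)
  have h : Q {ω : Path | Block j k (ω.at' s).1} = Psi ρ {η | Block j k η} := by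
    rw [← hQ.stationary s, Measure.map_apply hm (measurableSet_block j k)]
    rfl
  have hb : (fun ω : Path => blockIndicator j k (ω.seen s s)) =
      {ω : Path | Block j k (ω.at' s).1}.indicator 1 := by
    ext ω
    have hl : (ω.seen s s).2 = (0, 0) := (ω.seen_labels_eq_zero_iff s s).2 rfl
    by_cases hB : Block j k (ω.at' s).1
    · rw [blockIndicator_of_pos hl hB, Set.indicator_of_mem (by exact hB), Pi.one_apply]
    · rw [blockIndicator_of_not_block (by exact hB), Set.indicator_of_notMem (by exact hB)]
  rw [blockMass, hb, integral_indicator_one hms, measureReal_def, h,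
    Psi_block, ENNReal.toReal_ofReal (by positivity)]
  simp [blockProb]

lemma IsStationaryLaw.blockMass_eq_blockProb (hQ : IsStationaryLaw ρ Q) {s t : ℝ} (h : s ≤ t)
    (j k : ℕ) : blockMass Q s j k t = blockProb ρ j k (t - s) := by
  have := hQ.prob
  have key := eq_blockProb ρ.2.1 ρ.2.2 (u := fun j k τ => blockMass Q s j k (s + τ))
    (fun j k => (hQ.continuousOn_blockMass s j k).comp (by fun_prop)
      fun τ hτ => Set.mem_Ici.2 (le_add_of_nonneg_right hτ))
    (fun j k τ _ => abs_blockMass_le s j k _)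
    (fun j k => by simpa using hQ.blockMass_self s j k)
    (fun j k τ hτ => by
      simp only [add_zero]
      rw [hQ.blockMass_eq le_rfl (le_add_of_nonneg_right hτ),
        intervalIntegral.integral_comp_add_left (f := fun r => blockMass Q s j (k + 1) r +
          blockMass Q s (j + 1) k r - 2 * blockMass Q s j k r), add_zero])
    (j := j) (k := k) (sub_nonneg.2 h)
  simpa using key

/-- The probability that the pair does not move between the times `s` and `t`. -/
lemma IsStationaryLaw.labels_eq (hQ : IsStationaryLaw ρ Q) {s t : ℝ} (h : s ≤ t) :
    Q.real {ω : Path | (ω.at' t).2 = (ω.at' s).2} =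
      Real.exp (-(t - s)) * (1 + ρ * (1 - ρ) * (t - s)) ^ 2 := by
  have key := hQ.blockMass_eq_blockProb h 0 0
  have hb : (fun ω : Path => blockIndicator 0 0 (ω.seen s t)) =
      {ω : Path | (ω.at' t).2 = (ω.at' s).2}.indicator 1 := by
    ext ω
    by_cases hl : (ω.at' t).2 = (ω.at' s).2
    · rw [blockIndicator_of_pos ((ω.seen_labels_eq_zero_iff s t).2 hl)
        ⟨fun z hz hz' => by push_cast at hz'; omega, fun z hz hz' => by push_cast at hz; omega⟩,
        Set.indicator_of_mem (by exact hl), Pi.one_apply]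
    · rw [blockIndicator_of_labels (fun hc => hl ((ω.seen_labels_eq_zero_iff s t).1 hc)),
        Set.indicator_of_notMem (by exact hl)]
  rw [blockMass, hb, integral_indicator_one (measurableSet_labels_eq s t)] at key
  rw [key]
  simp only [blockProb, pow_zero, CharP.cast_eq_zero, zero_mul, add_zero, one_mul]
  ring

end

/-! ### Positions of labelled holes and particles -/

lemma le_labels_of_holeAt {X : State} {a y : ℤ} (h : HoleAt X a y) (hy : y < 0)
    (h0 : X.1 0 = false) : a < X.2.1 := by
  obtain ⟨-, rfl⟩ := h
  have : 0 < ((Finset.Ioc y 0).filter fun z => X.1 z = false).card :=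
    Finset.card_pos.2 ⟨0, by simp [hy, h0]⟩
  simp only [holeNumber, not_le.2 hy, if_false]
  omega

lemma nonneg_of_holeAt {X : State} {a y : ℤ} (h : HoleAt X a y) (h0 : X.1 0 = false)
    (ha : X.2.1 ≤ a) : 0 ≤ y := by
  by_contra! hc
  exact absurd (le_labels_of_holeAt h hc h0) (not_lt.2 ha)

lemma two_le_of_holeAt {X : State} {a y : ℤ} (h : HoleAt X a y) (h0 : X.1 0 = false)
    (h1 : X.1 1 = true) (ha : X.2.1 < a) : 2 ≤ y := by
  have hy := nonneg_of_holeAt h h0 ha.le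
  have hy0 : y ≠ 0 := by
    rintro rfl
    have h2 := h.2
    simp [holeNumber] at h2
    omega
  have hy1 : y ≠ 1 := by
    rintro rfl
    have := h.1
    simp [h1] at this
  omega

lemma le_one_of_particleAt {X : State} {b x : ℤ} (h : ParticleAt X b x) (hb : X.2.2 ≤ b) :
    x ≤ 1 := by
  by_contra! hc
  have hcard : 0 < ((Finset.Ioc 1 x).filter fun z => X.1 z = true).card :=
    Finset.card_pos.2 ⟨x, by simp [h.1, hc]⟩
  have h2 := h.2
  simp only [particleNumber, not_le.2 hc, if_false] at h2
  omega

lemma le_neg_one_of_particleAt {X : State} {b x : ℤ} (h : ParticleAt X b x)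
    (h0 : X.1 0 = false) (hb : X.2.2 < b) : x ≤ -1 := by
  have hx := le_one_of_particleAt h hb.le
  have hx1 : x ≠ 1 := by
    rintro rfl
    have h2 := h.2
    simp [particleNumber] at h2
    omega
  have hx0 : x ≠ 0 := by
    rintro rfl
    have := h.1
    simp [h0] at this
  omega

lemma holeAt_zero {X : State} (h0 : X.1 0 = false) : HoleAt X X.2.1 0 :=
  ⟨h0, by simp [holeNumber]⟩

lemma particleAt_one {X : State} (h1 : X.1 1 = true) : ParticleAt X X.2.2 1 :=
  ⟨h1, by simp [particleNumber]⟩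

/-- In the given state the hole labelled `a` is to the left of the particle labelled `b`. -/
def Switched (X : State) (a b : ℤ) : Prop :=
  ∃ y x : ℤ, HoleAt X a y ∧ ParticleAt X b x ∧ y < x

lemma switched_labels {X : State} (h0 : X.1 0 = false) (h1 : X.1 1 = true) :
    Switched X X.2.1 X.2.2 := ⟨0, 1, holeAt_zero h0, particleAt_one h1, one_pos⟩

/-- A hole labelled beyond that of the pair is at site 2 or further right, and a particle labelled
beyond that of the pair is at `-1` or further left. Among labels at least those of the pair, only
the pair itself has its hole to the left of its particle. -/
lemma Switched.labels_eq {X : State} {a b : ℤ} (h : Switched X a b) (h0 : X.1 0 = false)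
    (h1 : X.1 1 = true) (ha : X.2.1 ≤ a) (hb : X.2.2 ≤ b) : X.2 = (a, b) := by
  obtain ⟨y, x, hy, hx, hyx⟩ := h
  have hx1 := le_one_of_particleAt hx hb
  have hy0 := nonneg_of_holeAt hy h0 ha
  have ha' : X.2.1 = a := by
    refine le_antisymm ha (not_lt.1 fun hc => ?_)
    have := two_le_of_holeAt hy h0 h1 hc
    omega
  have hb' : X.2.2 = b := by
    refine le_antisymm hb (not_lt.1 fun hc => ?_)
    have := le_neg_one_of_particleAt hx h0 hc
    omega
  exact Prod.ext ha' hb'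

lemma Path.switched_iff_of_nonpos (ω : Path) {t : ℝ} (ht : t ≤ 0) :
    Switched (ω.at' t) 0 0 ↔ (ω.at' t).2 = (0, 0) := by
  have hl := ω.labels_le ht
  rw [ω.label_zero] at hl
  constructor
  · exact fun h => h.labels_eq (ω.pair t).1 (ω.pair t).2 hl.1 hl.2
  · intro h
    have := switched_labels (ω.pair t).1 (ω.pair t).2
    rwa [h] at this

lemma Path.exists_labels_eq (ω : Path) (t : ℝ) :
    ∃ u > t, ∀ s ∈ Ico t u, (ω.at' s).2 = (ω.at' t).2 := by
  have h : Tendsto (fun s => (ω.at' s).2) (𝓝[≥] t) (𝓝 (ω.at' t).2) :=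
    (continuous_snd.tendsto _).comp (ω.right_cont t)
  rw [nhds_discrete, tendsto_pure] at h
  obtain ⟨u, hu, hsub⟩ := mem_nhdsGE_iff_exists_Ico_subset.1 h
  exact ⟨u, hu, fun s hs => hsub hs⟩

lemma switchTime_eq (ω : Path) (a b : ℤ) :
    switchTime ω a b = sInf ((fun t : ℝ => (t : EReal)) '' {t | Switched (ω.at' t) a b}) := rfl

/-- The conditioning event thus depends on the state at the single time `s`, so its probability
comes from the law of the resting time. -/
lemma Path.lt_switchTime_iff (ω : Path) {s : ℝ} (hs : s < 0) :
    (s : EReal) < switchTime ω 0 0 ↔ (ω.at' s).2 ≠ (0, 0) := by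
  constructor
  · intro h hc
    refine absurd h (not_lt.2 (sInf_le ⟨s, ?_, rfl⟩))
    exact (ω.switched_iff_of_nonpos hs.le).2 hc
  · intro h
    -- Right-continuity of the discrete labels keeps the infimum strictly above `s`.
    obtain ⟨u, hu, hconst⟩ := ω.exists_labels_eq s
    have hmin : s < min u 0 := lt_min hu hs
    refine lt_of_lt_of_le (EReal.coe_lt_coe_iff.2 hmin) (le_sInf ?_)
    rintro _ ⟨t, ht, rfl⟩
    refine EReal.coe_le_coe_iff.2 (not_lt.1 fun hc => h ?_)
    have ht0 : t < 0 := hc.trans_le (min_le_right _ _)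
    have hl := (ω.switched_iff_of_nonpos ht0.le).1 ht
    rcases le_total s t with hst | hst
    · rw [← hconst t ⟨hst, hc.trans_le (min_le_left _ _)⟩, hl]
    · have h1 := ω.labels_le hst
      have h2 := ω.labels_le hs.le
      rw [hl] at h1
      rw [ω.label_zero] at h2
      exact le_antisymm h2 h1

/-- The first motion of the pair after time zero. -/
lemma Path.exists_switched (ω : Path) {h : ℝ} (hh : 0 ≤ h) (hl : (ω.at' h).2 ≠ (0, 0)) :
    ∃ t ≤ h, Switched (ω.at' t) 1 0 ∨ Switched (ω.at' t) 0 1 := by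
  set S : Set ℝ := {t | 0 ≤ t ∧ (ω.at' t).2 ≠ (0, 0)} with hS
  have hne : S.Nonempty := ⟨h, hh, hl⟩
  have hbdd : BddBelow S := ⟨0, fun t ht => ht.1⟩
  set τ := sInf S with hτ
  have hτ0 : 0 ≤ τ := le_csInf hne fun t ht => ht.1
  have hbefore : ∀ t, 0 ≤ t → t < τ → (ω.at' t).2 = (0, 0) := by
    intro t ht htτ
    by_contra hc
    exact absurd (csInf_le hbdd (show t ∈ S from ⟨ht, hc⟩)) (not_le.2 htτ)
  -- The infimum is attained by right-continuity, whereas the left limit at `τ` still has labels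
  -- `(0, 0)`; so the pair makes exactly one move at `τ`.
  have hτl : (ω.at' τ).2 ≠ (0, 0) := by
    intro hc
    obtain ⟨u, hu, hconst⟩ := ω.exists_labels_eq τ
    refine absurd (le_csInf hne fun t ht => ?_) (not_le.2 hu)
    by_contra! htu
    rcases lt_or_ge t τ with htτ | htτ
    · exact ht.2 (hbefore t ht.1 htτ)
    · exact ht.2 ((hconst t ⟨htτ, htu⟩).trans hc)
  have hτpos : 0 < τ := by
    refine hτ0.lt_of_ne fun hc => hτl ?_
    rw [← hc, ω.label_zero]
  refine ⟨τ, csInf_le hbdd ⟨hh, hl⟩, ?_⟩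
  obtain ⟨X, hX, hXτ⟩ := ω.left_lim τ
  have hX2 : X.2 = (0, 0) := by
    have h1 : Tendsto (fun s => (ω.at' s).2) (𝓝[<] τ) (𝓝 X.2) :=
      (continuous_snd.tendsto _).comp hX
    rw [nhds_discrete, tendsto_pure] at h1
    obtain ⟨t, ht, ht'⟩ := (h1.and (Ioo_mem_nhdsLT hτpos)).exists
    rw [← ht, hbefore t ht'.1.le ht'.2]
  rcases hXτ with hc | ⟨x, hx, -, hjump⟩
  · exact absurd (hc.trans hX2) hτl
  have hsw := switched_labels (ω.pair τ).1 (ω.pair τ).2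
  rcases hx with rfl | rfl
  · left
    have h2 : (ω.at' τ).2 = (1, 0) := by rw [hjump]; simp [jump, hX2]
    rwa [h2] at hsw
  · right
    have h2 : (ω.at' τ).2 = (0, 1) := by rw [hjump]; simp [jump, hX2]
    rwa [h2] at hsw

lemma Path.not_switched_of_labels_le (ω : Path) {t : ℝ} (h : (ω.at' t).2 ≤ (0, 0)) :
    ¬ Switched (ω.at' t) 1 0 ∧ ¬ Switched (ω.at' t) 0 1 := by
  have h1 := h.1
  have h2 := h.2
  constructor <;> intro hc
  · have := hc.labels_eq (ω.pair t).1 (ω.pair t).2 (by simp at h1 ⊢; omega) h2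
    simp [this] at h1
  · have := hc.labels_eq (ω.pair t).1 (ω.pair t).2 h1 (by simp at h2 ⊢; omega)
    simp [this] at h2

/-- If the pair jumps at time zero and moves eventually, then its weight is the time of its first
motion. -/
lemma Path.lt_weight_iff (ω : Path) (hneg : ∀ s < 0, (ω.at' s).2 ≠ (0, 0))
    (hpos : ∃ s ≥ 0, (ω.at' s).2 ≠ (0, 0)) {h : ℝ} (hh : 0 ≤ h) :
    h < weight ω (0, 0) ↔ (ω.at' h).2 = (0, 0) := by
  have h00 : switchTime ω 0 0 = 0 := by
    rw [switchTime_eq]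
    refine le_antisymm (sInf_le ⟨0, (ω.switched_iff_of_nonpos le_rfl).2 ω.label_zero, rfl⟩)
      (le_sInf ?_)
    rintro _ ⟨t, ht, rfl⟩
    refine EReal.coe_nonneg.2 (not_lt.1 fun hc => hneg t hc ?_)
    exact (ω.switched_iff_of_nonpos hc.le).1 ht
  set m := min (switchTime ω 1 0) (switchTime ω 0 1) with hm
  have hw : weight ω (0, 0) = m.toReal := by simp [weight, h00, hm]
  have hle : ∀ t, Switched (ω.at' t) 1 0 ∨ Switched (ω.at' t) 0 1 → m ≤ t := by
    rintro t (ht | ht)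
    · exact (min_le_left _ _).trans (sInf_le ⟨t, ht, rfl⟩)
    · exact (min_le_right _ _).trans (sInf_le ⟨t, ht, rfl⟩)
  have hge : ∀ u : ℝ, (∀ t, Switched (ω.at' t) 1 0 ∨ Switched (ω.at' t) 0 1 → u ≤ t) → u ≤ m := by
    intro u hu
    refine le_min (le_sInf ?_) (le_sInf ?_) <;> rintro _ ⟨t, ht, rfl⟩
    · exact EReal.coe_le_coe_iff.2 (hu t (Or.inl ht))
    · exact EReal.coe_le_coe_iff.2 (hu t (Or.inr ht))
  have hstart : ∀ u : ℝ, (ω.at' u).2 ≤ (0, 0) →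
      ∀ t, Switched (ω.at' t) 1 0 ∨ Switched (ω.at' t) 0 1 → u ≤ t := by
    intro u hu t ht
    by_contra! hc
    have := ω.not_switched_of_labels_le ((ω.labels_le hc.le).trans hu)
    exact ht.elim this.1 this.2
  have hm0 : (0 : EReal) ≤ m := hge 0 (hstart 0 ω.label_zero.le)
  -- As `toReal` sends `⊤` to `0`, a pair that never moves would receive weight zero; `hpos`
  -- excludes this.
  have hmtop : m ≠ ⊤ := by
    obtain ⟨s, hs, hsl⟩ := hpos
    obtain ⟨t, -, ht⟩ := ω.exists_switched hs hsl
    exact ne_top_of_le_ne_top (EReal.coe_ne_top t) (hle t ht)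
  have hcoe : ((m.toReal : ℝ) : EReal) = m :=
    EReal.coe_toReal hmtop (ne_bot_of_le_ne_bot (by simp) hm0)
  rw [hw]
  constructor
  · intro hlt
    by_contra hc
    obtain ⟨t, hth, ht⟩ := ω.exists_switched hh hc
    have h1 := hle t ht
    rw [← hcoe, EReal.coe_le_coe_iff] at h1
    linarith
  · intro hl
    obtain ⟨u, hu, hconst⟩ := ω.exists_labels_eq h
    have h1 : ((h + u) / 2 : ℝ) ≤ m :=
      hge _ (hstart _ ((hconst _ ⟨by linarith, by linarith⟩).trans hl).le)
    rw [← hcoe, EReal.coe_le_coe_iff] at h1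
    linarith

/-! ### Measurability of the environment -/

/-- The property factors through finitely many sites and the labels, a countable discrete space in
which every set is open and measurable. -/
lemma isOpen_of_dependsOn {P : State → Prop} {s : Finset ℤ}
    (h : ∀ X X' : State, (∀ z ∈ s, X.1 z = X'.1 z) → X.2 = X'.2 → (P X ↔ P X')) :
    IsOpen {X | P X} ∧ MeasurableSet {X | P X} := by
  set r : State → (s → Bool) × (ℤ × ℤ) := fun X => (fun z => X.1 z, X.2) with hr
  have hcont : Continuous r := by fun_prop
  have hmeas : Measurable r := by fun_prop
  have hset : {X | P X} = r ⁻¹' (r '' {X | P X}) := by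
    refine Set.Subset.antisymm (Set.subset_preimage_image _ _) ?_
    rintro X ⟨X', hX', hXX⟩
    refine (h X' X (fun z hz => ?_) ?_).1 hX'
    · exact congrFun (congrArg Prod.fst hXX) ⟨z, hz⟩
    · have h2 := congrArg Prod.snd hXX
      exact h2
  rw [hset]
  exact ⟨(isOpen_discrete _).preimage hcont, hmeas (MeasurableSet.of_discrete)⟩

lemma holeAt_congr {X X' : State} {a y : ℤ} (h : ∀ z ∈ Finset.Icc (-|y|) |y|, X.1 z = X'.1 z)
    (h2 : X.2 = X'.2) : HoleAt X a y ↔ HoleAt X' a y := by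
  have hy1 := neg_abs_le y
  have hy2 := le_abs_self y
  have hn : holeNumber X.1 y = holeNumber X'.1 y := by
    unfold holeNumber
    split_ifs <;> congr 2
    · refine Finset.filter_congr fun z hz => ?_
      rw [Finset.mem_Ioc] at hz
      rw [h z (by rw [Finset.mem_Icc]; omega)]
    · congr 1
      refine Finset.filter_congr fun z hz => ?_
      rw [Finset.mem_Ioc] at hz
      rw [h z (by rw [Finset.mem_Icc]; omega)]
  unfold HoleAt
  rw [hn, h y (by rw [Finset.mem_Icc]; omega), h2]

lemma particleAt_congr {X X' : State} {b x : ℤ}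
    (h : ∀ z ∈ Finset.Icc (-(|x| + 1)) (|x| + 1), X.1 z = X'.1 z)
    (h2 : X.2 = X'.2) : ParticleAt X b x ↔ ParticleAt X' b x := by
  have hy1 := neg_abs_le x
  have hy2 := le_abs_self x
  have hn : particleNumber X.1 x = particleNumber X'.1 x := by
    unfold particleNumber
    split_ifs <;> congr 2
    · refine Finset.filter_congr fun z hz => ?_
      rw [Finset.mem_Ico] at hz
      rw [h z (by rw [Finset.mem_Icc]; omega)]
    · congr 1
      refine Finset.filter_congr fun z hz => ?_
      rw [Finset.mem_Ioc] at hz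
      rw [h z (by rw [Finset.mem_Icc]; omega)]
  unfold ParticleAt
  rw [hn, h x (by rw [Finset.mem_Icc]; omega), h2]

lemma isOpen_holeAt (a y : ℤ) :
    IsOpen {X : State | HoleAt X a y} ∧ MeasurableSet {X : State | HoleAt X a y} :=
  isOpen_of_dependsOn fun _ _ h h2 => holeAt_congr h h2

lemma isOpen_particleAt (b x : ℤ) :
    IsOpen {X : State | ParticleAt X b x} ∧ MeasurableSet {X : State | ParticleAt X b x} :=
  isOpen_of_dependsOn fun _ _ h h2 => particleAt_congr h h2

lemma isOpen_switched (a b : ℤ) :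
    IsOpen {X : State | Switched X a b} ∧ MeasurableSet {X : State | Switched X a b} := by
  have : {X : State | Switched X a b} = ⋃ y : ℤ, ⋃ x : ℤ, ⋃ _ : y < x,
      {X : State | HoleAt X a y} ∩ {X : State | ParticleAt X b x} := by
    ext X
    simp only [Switched, Set.mem_ofPred_eq, Set.mem_iUnion, Set.mem_inter_iff, exists_prop]
    refine exists_congr fun y => exists_congr fun x => ?_
    tauto
  rw [this]
  exact ⟨isOpen_iUnion fun y => isOpen_iUnion fun x => isOpen_iUnion fun _ =>
      (isOpen_holeAt a y).1.inter (isOpen_particleAt b x).1,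
    MeasurableSet.iUnion fun y => MeasurableSet.iUnion fun x => MeasurableSet.iUnion fun _ =>
      (isOpen_holeAt a y).2.inter (isOpen_particleAt b x).2⟩

/-- By right-continuity, visits to an open set can be observed at rational times. -/
lemma measurableSet_exists_mem {U : Set State} (hU : IsOpen U) (hUm : MeasurableSet U)
    {I : Set ℝ} (hI : IsOpen I) : MeasurableSet {ω : Path | ∃ t ∈ I, ω.at' t ∈ U} := by
  have : {ω : Path | ∃ t ∈ I, ω.at' t ∈ U} =
      ⋃ q : ℚ, ⋃ _ : (q : ℝ) ∈ I, (fun ω : Path => ω.at' q) ⁻¹' U := by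
    ext ω
    simp only [Set.mem_ofPred_eq, Set.mem_iUnion, Set.mem_preimage, exists_prop]
    constructor
    · rintro ⟨t, htI, htU⟩
      have h1 : ∀ᶠ s in 𝓝[≥] t, ω.at' s ∈ U := ω.right_cont t (hU.mem_nhds htU)
      have h2 : ∀ᶠ s in 𝓝[≥] t, s ∈ I := mem_nhdsWithin_of_mem_nhds (hI.mem_nhds htI)
      obtain ⟨u, hu, hsub⟩ := mem_nhdsGE_iff_exists_Ico_subset.1 (h1.and h2)
      obtain ⟨q, hq1, hq2⟩ := exists_rat_btwn (show t < u from hu)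
      have := hsub ⟨hq1.le, hq2⟩
      exact ⟨q, this.2, this.1⟩
    · rintro ⟨q, hq, hqU⟩
      exact ⟨q, hq, hqU⟩
  rw [this]
  exact MeasurableSet.iUnion fun q => MeasurableSet.iUnion fun _ => measurable_at q hUm

lemma measurable_switchTime (a b : ℤ) : Measurable fun ω : Path => switchTime ω a b := by
  refine measurable_of_Iio fun c => ?_
  have : (fun ω : Path => switchTime ω a b) ⁻¹' Iio c =
      {ω : Path | ∃ t ∈ {t : ℝ | (t : EReal) < c}, ω.at' t ∈ {X : State | Switched X a b}} := by
    ext ω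
    simp only [Set.mem_preimage, Set.mem_Iio, switchTime_eq, sInf_lt_iff, Set.mem_image,
      Set.mem_ofPred_eq]
    constructor
    · rintro ⟨_, ⟨t, ht, rfl⟩, htc⟩
      exact ⟨t, htc, ht⟩
    · rintro ⟨t, htc, ht⟩
      exact ⟨_, ⟨t, ht, rfl⟩, htc⟩
  rw [this]
  exact measurableSet_exists_mem (isOpen_switched a b).1 (isOpen_switched a b).2
    (isOpen_Iio.preimage continuous_coe_real_ereal)

lemma measurable_weight (v : ℤ × ℤ) : Measurable fun ω : Path => weight ω v := by
  refine Measurable.ereal_toReal ?_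
  simp only [sub_eq_add_neg]
  exact ((measurable_switchTime _ _).min (measurable_switchTime _ _)).add
    (continuous_neg.measurable.comp (measurable_switchTime _ _))

lemma measurable_trace (v : ℤ × ℤ) : Measurable fun ω : Path => trace ω v := by
  have hU := (isOpen_holeAt v.1 0).1.inter (isOpen_particleAt v.2 1).1
  have hUm := (isOpen_holeAt v.1 0).2.inter (isOpen_particleAt v.2 1).2
  refine measurable_to_bool ?_
  have : (fun ω : Path => trace ω v) ⁻¹' {true} =
      {ω : Path | ∃ t ∈ (univ : Set ℝ),
        ω.at' t ∈ {X : State | HoleAt X v.1 0} ∩ {X : State | ParticleAt X v.2 1}} := by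
    ext ω
    simp [trace]
  rw [this]
  exact measurableSet_exists_mem hU hUm isOpen_univ

lemma measurable_environment : Measurable environment :=
  (measurable_pi_lambda _ measurable_weight).prodMk (measurable_pi_lambda _ measurable_trace)

/-! ### Tails of Gamma distributions -/

/-- `T` is minus an antiderivative of the density of shape `n + 1`, normalized to vanish at
infinity, hence the tail. -/
lemma gammaMeasure_Ioi {n : ℕ} {T : ℝ → ℝ}
    (hT : ∀ x, HasDerivAt T (-(x ^ n / n.factorial * Real.exp (-x))) x)
    (hlim : Tendsto T atTop (𝓝 0)) {h : ℝ} (hh : 0 ≤ h) :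
    gammaMeasure (n + 1) 1 (Ioi h) = ENNReal.ofReal (T h) := by
  have hpdf : ∀ x ∈ Ioi h,
      gammaPDF (n + 1) 1 x = ENNReal.ofReal (x ^ n / n.factorial * Real.exp (-x)) := by
    intro x hx
    rw [gammaPDF_of_nonneg (hh.trans (le_of_lt hx)), Real.Gamma_nat_eq_factorial,
      add_sub_cancel_right, Real.rpow_natCast, Real.one_rpow, one_mul]
    congr 1
    ring
  have hd : ∀ x ∈ Ici h,
      HasDerivAt (fun x => -T x) (x ^ n / n.factorial * Real.exp (-x)) x := by
    intro x _
    exact (hT x).fun_neg.congr_deriv (neg_neg _)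
  have hnn : ∀ x ∈ Ioi h, 0 ≤ x ^ n / n.factorial * Real.exp (-x) := by
    intro x hx
    have : 0 ≤ x := hh.trans (le_of_lt hx)
    positivity
  have hlim' : Tendsto (fun x => -T x) atTop (𝓝 0) := by simpa using hlim.neg
  have hint := integral_Ioi_of_hasDerivAt_of_nonneg' hd hnn hlim'
  have hintg := integrableOn_Ioi_deriv_of_nonneg' hd hnn hlim'
  rw [gammaMeasure, withDensity_apply _ measurableSet_Ioi,
    setLIntegral_congr_fun measurableSet_Ioi hpdf, ← ofReal_integral_eq_lintegral_ofReal hintg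
      ((ae_restrict_iff' measurableSet_Ioi).2 (Eventually.of_forall hnn)), hint]
  simp

lemma hasDerivAt_exp_neg (x : ℝ) : HasDerivAt (fun x : ℝ => Real.exp (-x)) (-Real.exp (-x)) x := by
  simpa using (hasDerivAt_id x).neg.exp

lemma tendsto_quadratic_mul_exp_neg (a b c : ℝ) :
    Tendsto (fun x : ℝ => (a + b * x + c * x ^ 2) * Real.exp (-x)) atTop (𝓝 0) := by
  have h := fun n => Real.tendsto_pow_mul_exp_neg_atTop_nhds_zero n
  have := (((h 0).const_mul a).add ((h 1).const_mul b)).add ((h 2).const_mul c)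
  simp only [mul_zero, add_zero] at this
  refine this.congr fun x => ?_
  ring

lemma gammaMeasure_one_Ioi {h : ℝ} (hh : 0 ≤ h) :
    gammaMeasure 1 1 (Ioi h) = ENNReal.ofReal (Real.exp (-h)) := by
  have := gammaMeasure_Ioi (n := 0) (T := fun x => Real.exp (-x))
    (fun x => by simpa using hasDerivAt_exp_neg x)
    (by simpa using tendsto_quadratic_mul_exp_neg 1 0 0) hh
  simpa using this

lemma gammaMeasure_two_Ioi {h : ℝ} (hh : 0 ≤ h) :
    gammaMeasure 2 1 (Ioi h) = ENNReal.ofReal ((1 + h) * Real.exp (-h)) := by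
  have := gammaMeasure_Ioi (n := 1) (T := fun x => (1 + x) * Real.exp (-x))
    (fun x => by
      refine (((hasDerivAt_id x).const_add 1).mul (hasDerivAt_exp_neg x)).congr_deriv ?_
      simp
      ring)
    (by simpa using tendsto_quadratic_mul_exp_neg 1 1 0) hh
  norm_num at this
  exact this

lemma gammaMeasure_three_Ioi {h : ℝ} (hh : 0 ≤ h) :
    gammaMeasure 3 1 (Ioi h) = ENNReal.ofReal ((1 + h + h ^ 2 / 2) * Real.exp (-h)) := by
  have := gammaMeasure_Ioi (n := 2) (T := fun x => (1 + x + x ^ 2 / 2) * Real.exp (-x))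
    (fun x => by
      refine ((((hasDerivAt_id x).const_add 1).add ((hasDerivAt_pow 2 x).div_const 2)).mul
        (hasDerivAt_exp_neg x)).congr_deriv ?_
      simp [Nat.factorial]
      ring)
    (by
      refine (tendsto_quadratic_mul_exp_neg 1 1 (1 / 2)).congr fun x => ?_
      ring) hh
  norm_num at this
  exact this

lemma ext_of_tail {μ ν : Measure ℝ} [IsProbabilityMeasure μ] [IsProbabilityMeasure ν]
    (h0 : μ (Ioi 0) = 1) (h : ∀ x, 0 ≤ x → μ (Ioi x) = ν (Ioi x)) : μ = ν := by
  have hall : ∀ x, μ (Ioi x) = ν (Ioi x) := by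
    intro x
    rcases le_total 0 x with hx | hx
    · exact h x hx
    · rw [le_antisymm prob_le_one (h0 ▸ measure_mono (Ioi_subset_Ioi hx)),
        le_antisymm prob_le_one (((h 0 le_rfl).symm.trans h0) ▸ measure_mono (Ioi_subset_Ioi hx))]
  refine Measure.ext_of_Iic μ ν fun x => ?_
  rw [← compl_Ioi, prob_compl_eq_one_sub measurableSet_Ioi,
    prob_compl_eq_one_sub measurableSet_Ioi, hall]

/-- A law with this tail is a mixture of three Gamma distributions. -/
lemma eq_gamma_mixture {μ : Measure ℝ} [IsProbabilityMeasure μ] {a c : ℝ} (ha0 : 0 ≤ a)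
    (ha : a ≤ 1 / 2) (hc0 : 0 ≤ c) (hc : c ≤ 1 / 2)
    (h : ∀ x, 0 ≤ x → μ (Ioi x) =
      ENNReal.ofReal ((1 + a * x) * (1 + c * x) * Real.exp (-x))) :
    μ = ENNReal.ofReal (1 - a - c) • gammaMeasure 1 1 +
      ENNReal.ofReal (a + c - 2 * (a * c)) • gammaMeasure 2 1 +
      ENNReal.ofReal (2 * (a * c)) • gammaMeasure 3 1 := by
  -- The weights match `1 + (a + c) x + a c x²` with the Gamma tail polynomials `1`, `1 + x` and `1
  -- + x + x² / 2`. The middle weight equals `a (1 - c) + c (1 - a)`.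
  have hw0 : 0 ≤ 1 - a - c := by linarith
  have hw1 : 0 ≤ a + c - 2 * (a * c) := by nlinarith
  have hw2 : 0 ≤ 2 * (a * c) := by positivity
  have hp1 := isProbabilityMeasure_gammaMeasure (a := 1) (r := 1) one_pos one_pos
  have hp2 := isProbabilityMeasure_gammaMeasure (a := 2) (r := 1) two_pos one_pos
  have hp3 := isProbabilityMeasure_gammaMeasure (a := 3) (r := 1) three_pos one_pos
  have hprob : IsProbabilityMeasure (ENNReal.ofReal (1 - a - c) • gammaMeasure 1 1 +
      ENNReal.ofReal (a + c - 2 * (a * c)) • gammaMeasure 2 1 +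
      ENNReal.ofReal (2 * (a * c)) • gammaMeasure 3 1) := by
    constructor
    simp only [Measure.add_apply, Measure.smul_apply, measure_univ, smul_eq_mul, mul_one]
    rw [← ENNReal.ofReal_add hw0 hw1, ← ENNReal.ofReal_add (add_nonneg hw0 hw1) hw2,
      ENNReal.ofReal_eq_one]
    ring
  refine ext_of_tail (by simpa using h 0 le_rfl) fun x hx => ?_
  rw [h x hx]
  simp only [Measure.add_apply, Measure.smul_apply, smul_eq_mul]
  rw [gammaMeasure_one_Ioi hx, gammaMeasure_two_Ioi hx, gammaMeasure_three_Ioi hx,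
    ← ENNReal.ofReal_mul hw0, ← ENNReal.ofReal_mul hw1, ← ENNReal.ofReal_mul hw2,
    ← ENNReal.ofReal_add (by positivity) (by positivity),
    ← ENNReal.ofReal_add (by positivity) (by positivity)]
  congr 1
  ring

/-! ### The process conditioned on a jump of the pair at time zero -/

section

variable {ρ : unitInterval} {Q Q' : Measure Path}

lemma measurableSet_labels_eq_zero (t : ℝ) :
    MeasurableSet {ω : Path | (ω.at' t).2 = (0, 0)} :=
  measurableSet_of_comp (measurable_labels t) fun l => l = (0, 0)

lemma Path.labels_eq_zero_iff (ω : Path) (t : ℝ) :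
    (ω.at' t).2 = (0, 0) ↔ (ω.at' t).2 = (ω.at' 0).2 := by rw [ω.label_zero]

lemma Path.labels_eq_zero_of_le (ω : Path) {s t : ℝ} (hst : s ≤ t) (ht : t ≤ 0)
    (hs : (ω.at' s).2 = (0, 0)) : (ω.at' t).2 = (0, 0) :=
  le_antisymm (ω.label_zero ▸ ω.labels_le ht) (hs ▸ ω.labels_le hst)

/-- Labels are discrete, so the indicator of `(0, 0)` is a continuous test function and weak
convergence at one time is enough. -/
lemma IsConditionedOnJump.tendsto_labels (hQ' : IsConditionedOnJump Q Q') (t : ℝ) :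
    Tendsto (fun ε : ℝ => (cond Q {ω | (ω.at' (-ε)).2 ≠ (0, 0)}).real
        {ω | (ω.at' t).2 = (0, 0)})
      (𝓝[>] 0) (𝓝 (Q'.real {ω | (ω.at' t).2 = (0, 0)})) := by
  set f : ℤ × ℤ → ℝ := fun l => if l = (0, 0) then 1 else 0 with hf
  set g : BoundedContinuousFunction (Fin 1 → State) ℝ :=
    BoundedContinuousFunction.ofNormedAddCommGroup (fun X => f (X 0).2)
      ((continuous_of_discreteTopology (f := f)).comp (by fun_prop)) 1 (fun X => by
        simp only [hf]; split_ifs <;> simp) with hg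
  have hint : ∀ μ : Measure Path, ∫ ω, g (fun _ => ω.at' t) ∂μ =
      μ.real {ω | (ω.at' t).2 = (0, 0)} := by
    intro μ
    rw [← integral_indicator_one (measurableSet_labels_eq_zero t)]
    congr 1
    ext ω
    simp [hg, hf, Set.indicator_apply]
  have key := hQ'.tendsto 1 (fun _ => t) g
  simp only [hint] at key
  refine key.congr' ?_
  filter_upwards [self_mem_nhdsWithin] with ε hε
  congr 2
  ext ω
  exact ω.lt_switchTime_iff (neg_lt_zero.2 hε)

/-- For `ε < -s`, labels `(0, 0)` at time `s` would persist up to `-ε`, which the conditioning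
forbids; the approximating probabilities are eventually zero. -/
lemma IsConditionedOnJump.labels_neg (hQ' : IsConditionedOnJump Q Q') {s : ℝ} (hs : s < 0) :
    Q'.real {ω | (ω.at' s).2 = (0, 0)} = 0 := by
  refine tendsto_nhds_unique (hQ'.tendsto_labels s) (tendsto_const_nhds.congr' ?_)
  filter_upwards [Ioo_mem_nhdsGT (neg_pos.2 hs)] with ε hε
  have hms : MeasurableSet {ω : Path | (ω.at' (-ε)).2 ≠ (0, 0)} :=
    (measurableSet_labels_eq_zero (-ε)).compl
  have hempty : {ω : Path | (ω.at' (-ε)).2 ≠ (0, 0)} ∩ {ω | (ω.at' s).2 = (0, 0)} = ∅ := by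
    ext ω
    simp only [Set.mem_inter_iff, Set.mem_ofPred_eq, Set.mem_empty_iff_false, iff_false, not_and]
    exact fun h hc => h (ω.labels_eq_zero_of_le (by linarith [hε.2]) (by linarith [hε.1]) hc)
  rw [measureReal_def, cond_apply hms, hempty]
  simp

/-- The tail of the first time when the pair moves, for the stationary process. -/
noncomputable def stayProb (c t : ℝ) : ℝ := Real.exp (-t) * (1 + c * t) ^ 2

lemma hasDerivAt_stayProb (c t : ℝ) :
    HasDerivAt (stayProb c) (-((1 - 2 * c + c * t) * (1 + c * t) * Real.exp (-t))) t := by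
  have h2 : HasDerivAt (fun t : ℝ => 1 + c * t) c t := by
    simpa using ((hasDerivAt_id t).const_mul c).const_add 1
  refine ((hasDerivAt_exp_neg t).mul (h2.pow 2)).congr_deriv ?_
  simp
  ring

/-- Resting during `[0, h]` but not during `[-ε, h]` has probability `F(h) - F(h + ε)`. The factors
`ε⁻¹` cancel; they are kept to display two difference quotients. -/
lemma IsStationaryLaw.cond_labels (hQ : IsStationaryLaw ρ Q) {ε h : ℝ} (hε : 0 < ε)
    (hh : 0 ≤ h) :
    (cond Q {ω | (ω.at' (-ε)).2 ≠ (0, 0)}).real {ω | (ω.at' h).2 = (0, 0)} =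
      (ε⁻¹ • (stayProb (ρ * (1 - ρ)) (h + ε) - stayProb (ρ * (1 - ρ)) h)) /
        (ε⁻¹ • (stayProb (ρ * (1 - ρ)) (0 + ε) - stayProb (ρ * (1 - ρ)) 0)) := by
  have := hQ.prob
  set c : ℝ := ρ * (1 - ρ) with hc
  have hms := measurableSet_labels_eq_zero (-ε)
  have hmsc : MeasurableSet {ω : Path | (ω.at' (-ε)).2 ≠ (0, 0)} := hms.compl
  have h1 : Q.real {ω | (ω.at' (-ε)).2 = (0, 0)} = stayProb c ε := by
    have h := hQ.labels_eq (s := -ε) (t := 0) (by linarith)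
    rw [sub_neg_eq_add, zero_add] at h
    rw [stayProb, ← h]
    congr 1
    ext ω
    exact (ω.labels_eq_zero_iff _).trans eq_comm
  have h2 : Q.real {ω | (ω.at' h).2 = (0, 0)} = stayProb c h := by
    have h' := hQ.labels_eq hh
    rw [sub_zero] at h'
    rw [stayProb, ← h']
    congr 1
    ext ω
    exact ω.labels_eq_zero_iff _
  have h3 : Q.real ({ω | (ω.at' h).2 = (0, 0)} ∩ {ω | (ω.at' (-ε)).2 = (0, 0)}) =
      stayProb c (h + ε) := by
    have h' := hQ.labels_eq (s := -ε) (t := h) (by linarith)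
    rw [sub_neg_eq_add] at h'
    rw [stayProb, ← h']
    congr 1
    ext ω
    simp only [Set.mem_inter_iff, Set.mem_ofPred_eq]
    refine ⟨fun h => h.1.trans h.2.symm, fun h => ?_⟩
    have h4 := ω.labels_eq_of_le (by linarith) hh h
    rw [ω.label_zero] at h4
    exact ⟨h.trans h4.symm, h4.symm⟩
  have h4 : Q.real {ω | (ω.at' (-ε)).2 ≠ (0, 0)} = 1 - stayProb c ε := by
    rw [← h1, ← probReal_compl_eq_one_sub hms]
    rfl
  have h5 : Q.real ({ω | (ω.at' (-ε)).2 ≠ (0, 0)} ∩ {ω | (ω.at' h).2 = (0, 0)}) =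
      stayProb c h - stayProb c (h + ε) := by
    rw [← h2, ← h3,
      ← measureReal_inter_add_sdiff (μ := Q) (s := {ω : Path | (ω.at' h).2 = (0, 0)}) hms,
      add_sub_cancel_left, Set.inter_comm]
    rfl
  have h6 : stayProb c 0 = 1 := by simp [stayProb]
  rw [measureReal_def, cond_apply hmsc, ENNReal.toReal_mul, ENNReal.toReal_inv,
    ← measureReal_def, ← measureReal_def, h4, h5, zero_add, h6, smul_eq_mul, smul_eq_mul,
    mul_div_mul_left _ _ (inv_ne_zero hε.ne'), ← neg_div_neg_eq, neg_sub, neg_sub, div_eq_inv_mul]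

/-- The tail of the weight of the pair that appears at time zero. -/
lemma labels_conditioned (hQ : IsStationaryLaw ρ Q) (hQ' : IsConditionedOnJump Q Q') {h : ℝ}
    (hh : 0 ≤ h) :
    Q'.real {ω | (ω.at' h).2 = (0, 0)} =
      (1 + (ρ : ℝ) * (1 - ρ) * h / ((1 - ρ) ^ 2 + (ρ : ℝ) ^ 2)) *
          (1 + (ρ : ℝ) * (1 - ρ) * h) * Real.exp (-h) := by
  have hD : (0 : ℝ) < (1 - ρ) ^ 2 + (ρ : ℝ) ^ 2 := by nlinarith [sq_nonneg ((ρ : ℝ) - 1 / 2)]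
  have hD' : 1 - 2 * ((ρ : ℝ) * (1 - ρ)) = (1 - ρ) ^ 2 + (ρ : ℝ) ^ 2 := by ring
  have ht := hQ'.tendsto_labels h
  have hlim := (hasDerivAt_stayProb (ρ * (1 - ρ)) h).tendsto_slope_zero_right.div
    (hasDerivAt_stayProb (ρ * (1 - ρ)) 0).tendsto_slope_zero_right (by
      simp only [mul_zero, add_zero, neg_zero, Real.exp_zero, mul_one, hD']
      exact neg_ne_zero.2 hD.ne')
  have heq := tendsto_nhds_unique ht (hlim.congr' (by
    filter_upwards [self_mem_nhdsWithin] with ε hε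
    exact (hQ.cond_labels hε hh).symm))
  rw [heq]
  simp only [mul_zero, add_zero, neg_zero, Real.exp_zero, mul_one, hD']
  rw [neg_div_neg_eq]
  field_simp

/-- For negative times it is enough to exclude `-1 / (n + 1)`, because labels `(0, 0)` persist up to
time zero. The pair moves eventually because the tail in `labels_conditioned` vanishes at infinity.
-/
lemma ae_jump_and_move (hQ : IsStationaryLaw ρ Q) (hQ' : IsConditionedOnJump Q Q') :
    ∀ᵐ ω ∂Q', (∀ s < 0, (ω.at' s).2 ≠ (0, 0)) ∧ ∃ s ≥ 0, (ω.at' s).2 ≠ (0, 0) := by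
  have := hQ'.prob
  refine Filter.Eventually.and ?_ ?_
  · have h1 : ∀ᵐ ω ∂Q', ∀ n : ℕ, (ω.at' (-(1 / ((n : ℝ) + 1)))).2 ≠ (0, 0) := by
      refine ae_all_iff.2 fun n => ?_
      have h := hQ'.labels_neg (s := -(1 / ((n : ℝ) + 1))) (neg_lt_zero.2 (by positivity))
      rw [measureReal_eq_zero_iff] at h
      rw [ae_iff]
      simpa using h
    filter_upwards [h1] with ω hω s hs hc
    obtain ⟨n, hn⟩ := exists_nat_one_div_lt (neg_pos.2 hs)
    refine hω n (ω.labels_eq_zero_of_le (by linarith) ?_ hc)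
    have : (0 : ℝ) < 1 / ((n : ℝ) + 1) := by positivity
    linarith
  · set N : Set Path := {ω | ¬ ∃ s ≥ (0 : ℝ), (ω.at' s).2 ≠ (0, 0)} with hN
    have hle : ∀ h : ℝ, 0 ≤ h → Q'.real N ≤ Q'.real {ω | (ω.at' h).2 = (0, 0)} := by
      intro h hh
      refine measureReal_mono fun ω hω => ?_
      by_contra hc
      exact hω ⟨h, hh, hc⟩
    have hlim : Tendsto (fun h : ℝ => Q'.real {ω | (ω.at' h).2 = (0, 0)}) atTop (𝓝 0) := by
      set c : ℝ := ρ * (1 - ρ) with hc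
      set D : ℝ := (1 - ρ) ^ 2 + (ρ : ℝ) ^ 2 with hD
      refine (tendsto_quadratic_mul_exp_neg 1 (c / D + c) (c / D * c)).congr' ?_
      filter_upwards [eventually_ge_atTop 0] with h hh
      rw [labels_conditioned hQ hQ' hh]
      ring
    have h0 : Q'.real N ≤ 0 := ge_of_tendsto hlim (by
      filter_upwards [eventually_ge_atTop 0] with h hh
      exact hle h hh)
    have h1 := le_antisymm h0 measureReal_nonneg
    rw [measureReal_eq_zero_iff] at h1
    exact h1

lemma weight_tail (hQ : IsStationaryLaw ρ Q) (hQ' : IsConditionedOnJump Q Q') {h : ℝ}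
    (hh : 0 ≤ h) :
    (Q'.map environment) {e | h < e.1 (0, 0)} = ENNReal.ofReal
        ((1 + (ρ : ℝ) * (1 - ρ) * h / ((1 - ρ) ^ 2 + (ρ : ℝ) ^ 2)) *
          (1 + (ρ : ℝ) * (1 - ρ) * h) * Real.exp (-h)) := by
  have := hQ'.prob
  rw [← labels_conditioned hQ hQ' hh, ofReal_measureReal, Measure.map_apply measurable_environment
    (measurableSet_lt measurable_const (by fun_prop))]
  refine measure_congr ?_
  filter_upwards [ae_jump_and_move hQ hQ'] with ω hω
  exact propext (ω.lt_weight_iff hω.1 hω.2 hh)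

end

end TasepPair

/-! ### The tail formula and the Gamma mixture -/

open TasepPair in
theorem proposition1p5 (ρ : unitInterval) (hρ₀ : 0 < ρ) (hρ₁ : ρ < 1)
    (ν : Measure TasepPair.Environment) (hν : TasepPair.IsLimitEnvironment ρ ν) :
    (∀ h : ℝ, 0 ≤ h →
      ν {e | h < e.1 (0, 0)} = ENNReal.ofReal
        ((1 + (ρ : ℝ) * (1 - ρ) * h / ((1 - ρ) ^ 2 + (ρ : ℝ) ^ 2)) *
          (1 + (ρ : ℝ) * (1 - ρ) * h) * Real.exp (-h))) ∧
    ∃ w : Fin 3 → ℝ, (∀ i, 0 ≤ w i) ∧ ∑ i, w i = 1 ∧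
      ν.map (fun e => e.1 (0, 0)) =
        ENNReal.ofReal (w 0) • gammaMeasure 1 1 + ENNReal.ofReal (w 1) • gammaMeasure 2 1 +
          ENNReal.ofReal (w 2) • gammaMeasure 3 1 ∧
      ((ρ : ℝ) = 1 / 2 → w 0 = 1 / 4 ∧ w 1 = 1 / 2 ∧ w 2 = 1 / 4) := by
  obtain ⟨Q, Q', hQ, hQ', rfl⟩ := hν
  have htail := fun (h : ℝ) (hh : 0 ≤ h) => weight_tail hQ hQ' hh
  refine ⟨htail, ?_⟩
  have := hQ'.prob
  have hprob : IsProbabilityMeasure (Q'.map environment) :=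
    Measure.isProbabilityMeasure_map measurable_environment.aemeasurable
  have hm : Measurable fun e : Environment => e.1 (0, 0) := by fun_prop
  have hprob' : IsProbabilityMeasure ((Q'.map environment).map fun e => e.1 (0, 0)) :=
    Measure.isProbabilityMeasure_map hm.aemeasurable
  have h0 : (0 : ℝ) ≤ ρ := ρ.2.1
  have h1 : (0 : ℝ) ≤ 1 - ρ := by linarith [ρ.2.2]
  have hD : (0 : ℝ) < (1 - ρ) ^ 2 + (ρ : ℝ) ^ 2 := by nlinarith [sq_nonneg ((ρ : ℝ) - 1 / 2)]
  set c : ℝ := ρ * (1 - ρ) with hc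
  set a : ℝ := c / ((1 - ρ) ^ 2 + (ρ : ℝ) ^ 2) with ha
  have hc0 : 0 ≤ c := by positivity
  have hc2 : c ≤ 1 / 2 := by nlinarith [sq_nonneg ((ρ : ℝ) - 1 / 2)]
  have ha0 : 0 ≤ a := by positivity
  -- Equivalent to `2 ρ (1 - ρ) ≤ (1 - ρ)² + ρ²`; with `c ≤ 1 / 2` it makes the weight `1 - a - c`
  -- nonnegative.
  have ha2 : a ≤ 1 / 2 := by
    rw [ha, div_le_iff₀ hD]
    nlinarith [sq_nonneg ((1 - ρ : ℝ) - ρ)]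
  refine ⟨![1 - a - c, a + c - 2 * (a * c), 2 * (a * c)], fun i => ?_, ?_, ?_, fun hρ => ?_⟩
  · fin_cases i
    · simp; linarith
    · simp; nlinarith
    · simp; positivity
  · simp only [Fin.sum_univ_three, Matrix.cons_val]
    ring
  · refine eq_gamma_mixture ha0 ha2 hc0 hc2 fun x hx => ?_
    rw [Measure.map_apply hm measurableSet_Ioi]
    refine (htail x hx).trans ?_
    congr 3
    rw [ha]
    ring
  · have hc4 : c = 1 / 4 := by rw [hc, hρ]; norm_num
    have ha4 : a = 1 / 2 := by rw [ha, hc4, hρ]; norm_num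
    simp [hc4, ha4]
    norm_num
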